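/- Let $K$ be a field of characteristic different from $2$ and let $(\mathcal A,A,A')$ be a quasi-twilled associative algebra over $K$: $\mathcal A$ is an associative (not necessarily unital) $K$-algebra, $\mathcal A=A\oplus A'$ as vector spaces, and $A'$ is a subalgebra. Write the multiplication of $\mathcal A$ as $$(x,u)\cdot(y,v)=\bigl(\pi(x,y)+\xi(x,v)+\eta(u,y),\ \beta(u,v)+\rho(x,v)+\mu(u,y)+\theta(x,y)\bigr),\qquad x,y\in A,\ u,v\in A',$$ with bilinear maps $\pi:A\otimes A\to A$, $\xi:A\otimes A'\to A$, $\eta:A'\otimes A\to A$, $\beta:A'\otimes A'\to A'$, $\rho:A\otimes A'\to A'$, $\mu:A'\otimes A\to A'$, $\theta:A\otimes A\to A'$. A right deformation map is a linear map $D:A\to A'$ such that for all $x,y\in A$ $$D\bigl(\pi(x,y)+\xi(x,Dy)+\eta(Dx,y)\bigr)=\rho(x,Dy)+\mu(Dx,y)+\beta(Dx,Dy)+\theta(x,y).$$ On $\bigoplus_{n\ge0}\mathrm{Hom}(\otimes^{n+1}\mathcal A,\mathcal A)$, where $\mathrm{Hom}(\otimes^{n+1}\mathcal A,\mathcal A)$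 has degree $n$, let $[f,g]_G=f\circ g-(-1)^{mn}g\circ f$ be the Gerstenhaber bracket ($f$ of degree $m$, $g$ of degree $n$), where $$(f\circ g)(x_1,\dots,x_{m+n+1})=\sum_{i=1}^{m+1}(-1)^{(i-1)n}f(x_1,\dots,x_{i-1},g(x_i,\dots,x_{i+n}),x_{i+n+1},\dots,x_{m+n+1}).$$ Multilinear maps on tensor products of copies of $A$ and $A'$ with values in $A$ or $A'$ are regarded as elements of this space, extended by zero on the other summands of $\otimes^{n+1}(A\oplus A')$. On $\mathfrak g=\bigoplus_{n\ge0}\mathrm{Hom}(\otimes^{n+1}A,A')$, graded by $n$, put $$l_0=\theta,\qquad l_1(f)=[\pi+\rho+\mu,f]_G,\qquad l_2(f,g)=[[\xi+\eta+\beta,f]_G,g]_G,\qquad l_k=0\ (k\ge3).$$ For $x\in\mathfrak g$ of degree $0$ the operations twisted by $x$ are $l_k^x(x_1,\dots,x_k)=\sum_{n\ge0}\frac1{n!}l_{n+k}(x,\dots,x,x_1,\dots,x_k)$ for $k\ge1$. Here an $L_\infty$-algebra consists of graded symmetric operations $l_k$ $(k\ge1)$ of degree $1$ on a $\mathbb Z$-graded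 vector space satisfying the generalized Jacobi identities $\sum_{i}\sum_{\sigma\in S(i,n-i)}\varepsilon(\sigma)\,l_{n-i+1}(l_i(x_{\sigma(1)},\dots,x_{\sigma(i)}),x_{\sigma(i+1)},\dots,x_{\sigma(n)})=0$, where $S(i,n-i)$ is the set of $(i,n-i)$-shuffles and $\varepsilon(\sigma)$ is the Koszul sign; a Maurer–Cartan element of it is a degree $0$ element $x$ with $\sum_{k\ge1}\frac1{k!}l_k(x,\dots,x)=0$. \textbf{Theorem.} Let $D:A\to A'$ be a right deformation map of $(\mathcal A,A,A')$. Then $(\mathfrak g,\{l_k^D\}_{k\ge1})$ is an $L_\infty$-algebra, with $l_1^D(f)=l_1(f)+l_2(D,f)$, $l_2^D=l_2$ and $l_k^D=0$ for $k\ge3$; and for every linear map $D':A\to A'$, the map $D+D'$ is a right deformation map of $(\mathcal A,A,A')$ if and only if $D'$ is a Maurer–Cartan element of the $L_\infty$-algebra $(\mathfrak g,l_1^D,l_2^D)$. -/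

import Mathlib

open scoped DirectSum

set_option maxSynthPendingDepth 3

noncomputable section

/-! ### Curved `L_∞`-algebras -/

section LInfinity

variable {K V : Type*} [Field K] [AddCommGroup V] [Module K V]

/-- The Koszul sign `ε(σ; x₁, …, xₙ)` of a permutation of homogeneous elements with `|xᵢ| = d i`:
one factor `(-1)^{|x_{σ p}| |x_{σ q}|}` for every inversion `p < q`, `σ q < σ p`. -/
def koszulSign {n : ℕ} (d : Fin n → ℤ) (σ : Equiv.Perm (Fin n)) : ℤˣ :=
  ∏ p ∈ Finset.univ.filter (fun p : Fin n × Fin n => p.1 < p.2 ∧ σ p.2 < σ p.1),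
    Int.negOnePow (d (σ p.1) * d (σ p.2))

/-- `σ` is an `(i, n - i)`-shuffle: increasing on the first `i` and on the last `n - i` places. -/
def IsShuffle {n : ℕ} (i : ℕ) (σ : Equiv.Perm (Fin n)) : Prop :=
  (∀ a b : Fin n, a < b → (b : ℕ) < i → σ a < σ b) ∧
    (∀ a b : Fin n, a < b → i ≤ (a : ℕ) → σ a < σ b)

open scoped Classical in
/-- A curved `L_∞`-algebra (in the convention in which all `l_k` are graded symmetric of degree
`1`) on the `ℤ`-graded vector space `V = ⨁ i, 𝒢 i`. -/
structure IsCurvedLInfinityAlgebra (𝒢 : ℤ → Submodule K V)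
    (l : ∀ k : ℕ, MultilinearMap K (fun _ : Fin k => V) V) : Prop where
  /-- `V` is the direct sum of its homogeneous parts. -/
  isInternal : DirectSum.IsInternal 𝒢
  /-- every `l_k` has degree `1`. -/
  degree_one : ∀ (k : ℕ) (d : Fin k → ℤ) (x : Fin k → V), (∀ i, x i ∈ 𝒢 (d i)) →
    l k x ∈ 𝒢 (∑ i, d i + 1)
  /-- graded symmetry. -/
  graded_symm : ∀ (n : ℕ) (d : Fin n → ℤ) (x : Fin n → V), (∀ i, x i ∈ 𝒢 (d i)) →
    ∀ σ : Equiv.Perm (Fin n), l n (fun a => x (σ a)) = koszulSign d σ • l n x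
  /-- generalized Jacobi identity. -/
  jacobi : ∀ (n : ℕ) (d : Fin n → ℤ) (x : Fin n → V), (∀ i, x i ∈ 𝒢 (d i)) →
    ∑ i : Fin (n + 1), ∑ σ ∈ Finset.univ.filter (fun σ : Equiv.Perm (Fin n) => IsShuffle i σ),
      koszulSign d σ •
        l (n - i + 1)
          (Fin.cons (l i (fun a : Fin i => x (σ ⟨a, by omega⟩)))
            (fun b : Fin (n - i) => x (σ ⟨i + b, by omega⟩))) = 0

/-- An `L_∞`-algebra is a curved `L_∞`-algebra with `l₀ = 0`. -/
structure IsLInfinityAlgebra (𝒢 : ℤ → Submodule K V)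
    (l : ∀ k : ℕ, MultilinearMap K (fun _ : Fin k => V) V) : Prop
    extends IsCurvedLInfinityAlgebra 𝒢 l where
  l_zero : l 0 = 0

/-- A Maurer–Cartan element: a degree `0` element `x` with `∑_{k ≥ 0} (1 / k!) l_k(x, …, x) = 0`,
where only finitely many terms are nonzero. -/
def IsMaurerCartan (𝒢 : ℤ → Submodule K V)
    (l : ∀ k : ℕ, MultilinearMap K (fun _ : Fin k => V) V) (x : V) : Prop :=
  x ∈ 𝒢 0 ∧ {k : ℕ | l k (fun _ => x) ≠ 0}.Finite ∧
    ∑ᶠ k : ℕ, ((k.factorial : K)⁻¹) • l k (fun _ => x) = 0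

/-- The operations twisted by `x`:
`l_k^x(x₁, …, x_k) = ∑_{n ≥ 0} (1 / n!) l_{n+k}(x, …, x, x₁, …, x_k)` for `k ≥ 1`, and no `l₀`
(the sum is meant for families in which only finitely many `l_k` are nonzero). -/
def twist (l : ∀ k : ℕ, MultilinearMap K (fun _ : Fin k => V) V) (x : V) :
    ∀ k : ℕ, MultilinearMap K (fun _ : Fin k => V) V
  | 0 => 0
  | k + 1 => ∑ᶠ n : ℕ, ((n.factorial : K)⁻¹) •
      ((l (n + (k + 1))).domDomCongr finSumFinEquiv.symm).currySum (fun _ : Fin n => x)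

/-- A bilinear map, as a multilinear map in two variables. -/
def bilinToMultilinear {N : Type*} [AddCommGroup N] [Module K N] (B : V →ₗ[K] V →ₗ[K] N) :
    MultilinearMap K (fun _ : Fin 2 => V) N :=
  LinearMap.uncurryLeft
    (((MultilinearMap.ofSubsingletonₗ K K V N (0 : Fin 1)).toLinearMap).comp B)

end LInfinity

/-! ### Cochains and the Gerstenhaber bracket -/

section Cochains

variable (K V N : Type*) [Field K] [AddCommGroup V] [Module K V] [AddCommGroup N] [Module K N]

/-- `Hom(⊗^{n+1} V, N)`. -/
abbrev Cochain (n : ℕ) : Type _ := MultilinearMap K (fun _ : Fin (n + 1) => V) N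

/-- `⨁_{n ≥ 0} Hom(⊗^{n+1} V, N)`. -/
abbrev Cochains : Type _ := ⨁ n : ℕ, Cochain K V N n

/-- The grading in which the elements of `Hom(⊗^{n+1} V, N)` have degree `n`. -/
def cochainDegree (i : ℤ) : Submodule K (Cochains K V N) where
  carrier := {f | ∀ n : ℕ, (n : ℤ) ≠ i → f n = 0}
  add_mem' := by
    intro f g hf hg n hn
    simp [hf n hn, hg n hn]
  zero_mem' := by
    intro n _
    rfl
  smul_mem' := by
    intro c f hf n hn
    rw [DirectSum.smul_apply, hf n hn, smul_zero]

variable {K V N}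

/-- A cochain of degree `n` as an element of the direct sum. -/
abbrev cochainOf (n : ℕ) : Cochain K V N n →ₗ[K] Cochains K V N :=
  DirectSum.lof K ℕ (fun n => Cochain K V N n) n

/-- A linear map as a cochain (of degree `0`). -/
def linCochain (f : V →ₗ[K] N) : Cochains K V N :=
  cochainOf 0 (MultilinearMap.ofSubsingleton K V N (0 : Fin 1) f)

/-- A bilinear map as a cochain (of degree `1`). -/
def bilinCochain (B : V →ₗ[K] V →ₗ[K] N) : Cochains K V N :=
  cochainOf 1 (bilinToMultilinear B)

/-- The argument list `x₁, …, x_{i-1}, g(x_i, …, x_{i+n}), x_{i+n+1}, …` (here `i` counts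
from `0`). -/
def insertArg {m n : ℕ} (g : (Fin (n + 1) → V) → V) (i : Fin (m + 1))
    (x : Fin (m + n + 1) → V) (j : Fin (m + 1)) : V :=
  if j < i then x ⟨j, by omega⟩
  else if j = i then g (fun k => x ⟨i + k, by omega⟩)
  else x ⟨j + n, by omega⟩

theorem insertArg_update_fst {m n : ℕ} [DecidableEq (Fin (m + n + 1))]
    (g : (Fin (n + 1) → V) → V) (i : Fin (m + 1)) (x : Fin (m + n + 1) → V)
    (a : Fin (m + n + 1)) (v : V) (h : (a : ℕ) < i) :
    insertArg g i (Function.update x a v) =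
      Function.update (insertArg g i x) ⟨a, by omega⟩ v := by
  funext j
  simp only [insertArg, Function.update_apply, Fin.ext_iff, Fin.lt_def]
  have h1 : ∀ k : Fin (n + 1), ((i : ℕ) + k = a) = False := fun k => by
    simp only [eq_iff_iff, iff_false]; omega
  simp only [h1, if_false]
  split_ifs <;> first | rfl | omega

theorem insertArg_update_mid {m n : ℕ} [DecidableEq (Fin (m + n + 1))]
    (g : (Fin (n + 1) → V) → V) (i : Fin (m + 1)) (x : Fin (m + n + 1) → V)
    (a : Fin (m + n + 1)) (v : V) (h : (i : ℕ) ≤ a) (h' : (a : ℕ) ≤ i + n) :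
    insertArg g i (Function.update x a v) =
      Function.update (insertArg g i x) i
        (g (Function.update (fun k : Fin (n + 1) => x ⟨i + k, by omega⟩)
          ⟨a - i, by omega⟩ v)) := by
  funext j
  have h2 : (fun k : Fin (n + 1) => Function.update x a v ⟨i + k, by omega⟩) =
      Function.update (fun k : Fin (n + 1) => x ⟨i + k, by omega⟩) ⟨a - i, by omega⟩ v := by
    funext k
    simp only [Function.update_apply, Fin.ext_iff]
    split_ifs <;> first | rfl | omega
  simp only [insertArg, h2]
  simp only [insertArg, Function.update_apply, Fin.ext_iff, Fin.lt_def]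
  split_ifs <;> first | rfl | omega

theorem insertArg_update_snd {m n : ℕ} [DecidableEq (Fin (m + n + 1))]
    (g : (Fin (n + 1) → V) → V) (i : Fin (m + 1)) (x : Fin (m + n + 1) → V)
    (a : Fin (m + n + 1)) (v : V) (h : (i : ℕ) + n < a) :
    insertArg g i (Function.update x a v) =
      Function.update (insertArg g i x) ⟨a - n, by omega⟩ v := by
  funext j
  simp only [insertArg, Function.update_apply, Fin.ext_iff, Fin.lt_def]
  have h1 : ∀ k : Fin (n + 1), ((i : ℕ) + k = a) = False := fun k => by
    simp only [eq_iff_iff, iff_false]; omega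
  simp only [h1, if_false]
  split_ifs <;> first | rfl | omega

/-- The insertion of `g` into the `i`-th place of `f` (`i` counts from `0`):
`f(x₁, …, x_{i-1}, g(x_i, …, x_{i+n}), x_{i+n+1}, …, x_{m+n+1})`. -/
def insertion {m n : ℕ} (f : Cochain K V V m) (g : Cochain K V V n) (i : Fin (m + 1)) :
    Cochain K V V (m + n) where
  toFun x := f (insertArg g i x)
  map_update_add' := by
    intro _ x a v w
    rcases lt_or_ge (a : ℕ) i with h | h
    · simp only [insertArg_update_fst _ _ _ _ _ h, f.map_update_add]
    · rcases le_or_gt (a : ℕ) (i + n) with h' | h'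
      · simp only [insertArg_update_mid _ _ _ _ _ h h', g.map_update_add, f.map_update_add]
      · simp only [insertArg_update_snd _ _ _ _ _ h', f.map_update_add]
  map_update_smul' := by
    intro _ x a c v
    rcases lt_or_ge (a : ℕ) i with h | h
    · simp only [insertArg_update_fst _ _ _ _ _ h, f.map_update_smul]
    · rcases le_or_gt (a : ℕ) (i + n) with h' | h'
      · simp only [insertArg_update_mid _ _ _ _ _ h h', g.map_update_smul, f.map_update_smul]
      · simp only [insertArg_update_snd _ _ _ _ _ h', f.map_update_smul]

theorem insertion_apply {m n : ℕ} (f : Cochain K V V m) (g : Cochain K V V n) (i : Fin (m + 1))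
    (x : Fin (m + n + 1) → V) : insertion f g i x = f (insertArg g i x) := rfl

theorem insertArg_eq_update {m n : ℕ} (g : (Fin (n + 1) → V) → V) (i : Fin (m + 1))
    (x : Fin (m + n + 1) → V) :
    insertArg g i x = Function.update (insertArg (fun _ => 0) i x) i
      (g (fun k => x ⟨i + k, by omega⟩)) := by
  funext j
  by_cases h : j = i
  · subst h; simp [insertArg]
  · simp [insertArg, h]

/-- The insertion as a bilinear map in `f` and `g`. -/
def insertionₗ (m n : ℕ) (i : Fin (m + 1)) :
    Cochain K V V m →ₗ[K] Cochain K V V n →ₗ[K] Cochain K V V (m + n) :=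
  LinearMap.mk₂ K (fun f g => insertion f g i)
    (fun _ _ _ => rfl) (fun _ _ _ => rfl)
    (fun f g g' => by
      ext x
      simp only [insertion_apply, add_apply]
      rw [insertArg_eq_update (⇑(g + g')), insertArg_eq_update g, insertArg_eq_update g',
        add_apply, f.map_update_add])
    (fun c f g => by
      ext x
      simp only [insertion_apply, smul_apply]
      rw [insertArg_eq_update (⇑(c • g)), insertArg_eq_update g,
        smul_apply, f.map_update_smul])

/-- `f ∘ g = ∑_{i} (-1)^{(i-1)n} f(x₁, …, x_{i-1}, g(x_i, …, x_{i+n}), …)` for `f` of degree `m`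
and `g` of degree `n`; with `i` counted from `0` the sign is `(-1)^{i n}`. -/
def gerstenhaberComp (m n : ℕ) :
    Cochain K V V m →ₗ[K] Cochain K V V n →ₗ[K] Cochain K V V (m + n) :=
  ∑ i : Fin (m + 1), ((-1 : K) ^ ((i : ℕ) * n)) • insertionₗ m n i

/-- `[f, g]_G = f ∘ g - (-1)^{m n} g ∘ f` for `f` of degree `m` and `g` of degree `n`. -/
def gerstenhaberBracketHom (m n : ℕ) :
    Cochain K V V m →ₗ[K] Cochain K V V n →ₗ[K] Cochains K V V :=
  (gerstenhaberComp m n).compr₂ (cochainOf (m + n)) -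
    ((-1 : K) ^ (m * n)) • ((gerstenhaberComp n m).compr₂ (cochainOf (n + m))).flip

/-- The Gerstenhaber bracket `[·, ·]_G` on `⨁_{n ≥ 0} Hom(⊗^{n+1} V, V)`: the bilinear extension
of the bracket of homogeneous elements. -/
def gerstenhaberBracket : Cochains K V V →ₗ[K] Cochains K V V →ₗ[K] Cochains K V V :=
  DirectSum.toModule K ℕ _ fun m =>
    (DirectSum.toModule K ℕ _ fun n => (gerstenhaberBracketHom m n).flip).flip

end Cochains

/-! ### Quasi-twilled associative algebras and right deformation maps -/

/-- A decomposition `𝒜 = A ⊕ A'` of an associative (not necessarily unital) algebra `𝒜` into two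
subspaces such that `A'` is a subalgebra; `(𝒜, A, A')` is a quasi-twilled associative algebra. -/
structure QuasiTwilled (K 𝒜 : Type*) [Field K] [NonUnitalRing 𝒜] [Module K 𝒜]
    [SMulCommClass K 𝒜 𝒜] [IsScalarTower K 𝒜 𝒜] where
  /-- the complement `A` -/
  A : Submodule K 𝒜
  /-- the subalgebra `A'` -/
  A' : Submodule K 𝒜
  isCompl : IsCompl A A'
  mul_mem : ∀ u ∈ A', ∀ v ∈ A', u * v ∈ A'

namespace QuasiTwilled

variable {K 𝒜 : Type*} [Field K] [NonUnitalRing 𝒜] [Module K 𝒜]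
  [SMulCommClass K 𝒜 𝒜] [IsScalarTower K 𝒜 𝒜] (Q : QuasiTwilled K 𝒜)

/-- The projection `𝒜 → A` along `A'`. -/
def pr : 𝒜 →ₗ[K] Q.A := Q.A.projectionOnto Q.A' Q.isCompl

/-- The projection `𝒜 → A'` along `A`. -/
def pr' : 𝒜 →ₗ[K] Q.A' := Q.A'.projectionOnto Q.A Q.isCompl.symm

/-- The component `π : A ⊗ A → A` of the multiplication. -/
def π : Q.A →ₗ[K] Q.A →ₗ[K] Q.A :=
  ((LinearMap.mul K 𝒜).compl₁₂ Q.A.subtype Q.A.subtype).compr₂ Q.pr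

/-- The component `θ : A ⊗ A → A'`. -/
def θ : Q.A →ₗ[K] Q.A →ₗ[K] Q.A' :=
  ((LinearMap.mul K 𝒜).compl₁₂ Q.A.subtype Q.A.subtype).compr₂ Q.pr'

/-- The component `ξ : A ⊗ A' → A`. -/
def ξ : Q.A →ₗ[K] Q.A' →ₗ[K] Q.A :=
  ((LinearMap.mul K 𝒜).compl₁₂ Q.A.subtype Q.A'.subtype).compr₂ Q.pr

/-- The component `ρ : A ⊗ A' → A'`. -/
def ρ : Q.A →ₗ[K] Q.A' →ₗ[K] Q.A' :=
  ((LinearMap.mul K 𝒜).compl₁₂ Q.A.subtype Q.A'.subtype).compr₂ Q.pr'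

/-- The component `η : A' ⊗ A → A`. -/
def η : Q.A' →ₗ[K] Q.A →ₗ[K] Q.A :=
  ((LinearMap.mul K 𝒜).compl₁₂ Q.A'.subtype Q.A.subtype).compr₂ Q.pr

/-- The component `μ : A' ⊗ A → A'`. -/
def μ : Q.A' →ₗ[K] Q.A →ₗ[K] Q.A' :=
  ((LinearMap.mul K 𝒜).compl₁₂ Q.A'.subtype Q.A.subtype).compr₂ Q.pr'

/-- The component `β : A' ⊗ A' → A'`. -/
def β : Q.A' →ₗ[K] Q.A' →ₗ[K] Q.A' :=
  ((LinearMap.mul K 𝒜).compl₁₂ Q.A'.subtype Q.A'.subtype).compr₂ Q.pr'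

/-- A right deformation map of `(𝒜, A, A')`. -/
def IsRightDeformationMap (D : Q.A →ₗ[K] Q.A') : Prop :=
  ∀ x y : Q.A, D (Q.π x y + Q.ξ x (D y) + Q.η (D x) y) =
    Q.ρ x (D y) + Q.μ (D x) y + Q.β (D x) (D y) + Q.θ x y

/-! The lifts to `𝒜 = A ⊕ A'` of the components: they act by the component on the respective
summand of `𝒜 ⊗ 𝒜` and by zero on the others. -/

/-- The lift of `π + ρ + μ`, an element of `Hom(𝒜 ⊗ 𝒜, 𝒜)`. -/
def liftπρμ : 𝒜 →ₗ[K] 𝒜 →ₗ[K] 𝒜 :=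
  (Q.π.compl₁₂ Q.pr Q.pr).compr₂ Q.A.subtype +
    (Q.ρ.compl₁₂ Q.pr Q.pr').compr₂ Q.A'.subtype +
    (Q.μ.compl₁₂ Q.pr' Q.pr).compr₂ Q.A'.subtype

/-- The lift of `ξ + η + β`, an element of `Hom(𝒜 ⊗ 𝒜, 𝒜)`. -/
def liftξηβ : 𝒜 →ₗ[K] 𝒜 →ₗ[K] 𝒜 :=
  (Q.ξ.compl₁₂ Q.pr Q.pr').compr₂ Q.A.subtype +
    (Q.η.compl₁₂ Q.pr' Q.pr).compr₂ Q.A.subtype +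
    (Q.β.compl₁₂ Q.pr' Q.pr').compr₂ Q.A'.subtype

/-- The lift `⨁ Hom(⊗^{n+1} A, A') → ⨁ Hom(⊗^{n+1} 𝒜, 𝒜)`: a cochain acts on `⊗^{n+1} A` and by
zero on the other summands of `⊗^{n+1} 𝒜`. -/
def lift : Cochains K Q.A Q.A' →ₗ[K] Cochains K 𝒜 𝒜 :=
  DirectSum.lmap fun n =>
    (Q.A'.subtype.compMultilinearMapₗ K).comp
      (MultilinearMap.compLinearMapₗ (fun _ : Fin (n + 1) => Q.pr))

/-- The projection `P` of `⨁ Hom(⊗^{n+1} 𝒜, 𝒜)` onto the subspace `⨁ Hom(⊗^{n+1} A, A')`. -/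
def proj : Cochains K 𝒜 𝒜 →ₗ[K] Cochains K Q.A Q.A' :=
  DirectSum.lmap fun n =>
    (Q.pr'.compMultilinearMapₗ K).comp
      (MultilinearMap.compLinearMapₗ (fun _ : Fin (n + 1) => Q.A.subtype))

/-- `l₀ = θ`. -/
def l₀ : Cochains K Q.A Q.A' := bilinCochain Q.θ

/-- `l₁(f) = [π + ρ + μ, f]_G`; `proj` only regards this element of `⨁ Hom(⊗^{n+1} A, A')` as
such. -/
def l₁ : Cochains K Q.A Q.A' →ₗ[K] Cochains K Q.A Q.A' :=
  (Q.proj.comp (gerstenhaberBracket (bilinCochain Q.liftπρμ))).comp Q.lift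

/-- `l₂(f, g) = [[ξ + η + β, f]_G, g]_G`; `proj` only regards this element of
`⨁ Hom(⊗^{n+1} A, A')` as such. -/
def l₂ : Cochains K Q.A Q.A' →ₗ[K] Cochains K Q.A Q.A' →ₗ[K] Cochains K Q.A Q.A' :=
  (gerstenhaberBracket.compl₁₂
    ((gerstenhaberBracket (bilinCochain Q.liftξηβ)).comp Q.lift) Q.lift).compr₂ Q.proj

/-- The curved `L_∞`-structure `(l₀, l₁, l₂)`, `l_k = 0` for `k ≥ 3`, on
`⨁ Hom(⊗^{n+1} A, A')`. -/
def l : ∀ k : ℕ, MultilinearMap K (fun _ : Fin k => Cochains K Q.A Q.A') (Cochains K Q.A Q.A')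
  | 0 => MultilinearMap.constOfIsEmpty K _ Q.l₀
  | 1 => MultilinearMap.ofSubsingleton K _ _ (0 : Fin 1) Q.l₁
  | 2 => bilinToMultilinear Q.l₂
  | _ + 3 => 0

/-- The operations `l_k^D` of the `L_∞`-algebra twisted by `D : A → A'`. -/
def twisted (D : Q.A →ₗ[K] Q.A') :
    ∀ k : ℕ, MultilinearMap K (fun _ : Fin k => Cochains K Q.A Q.A') (Cochains K Q.A Q.A') :=
  twist Q.l (linCochain D)

end QuasiTwilled

end

/-!
Give `A` degree `0` and `A'` degree `1`. The multiplication `M` of `𝒜` is then the sum of `θ`,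
`π + ρ + μ` and `ξ + η + β`, which raise the total degree by `1`, `0` and `-1`, and associativity,
`[M, M]_G = 0`, splits by weight into separate relations between these three. The cochains on `A`
with values in `A'` have weight `1`, while no nonzero cochain has weight `2`, so they form an
abelian subalgebra of the Gerstenhaber Lie algebra. By Voronov's derived bracket construction, `θ`,
`[π + ρ + μ, ·]` and `[[ξ + η + β, ·], ·]` make this subalgebra a curved differential graded Lie
algebra, in the shifted convention where all operations have degree `1`; this is a curved
`L_∞`-algebra with `l_k = 0` for `k ≥ 3`. The equation of a right deformation map is its
Maurer–Cartan equation. Twisting by a solution `D` removes the curvature, and the Maurer–Cartan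
equation at `D + D'` becomes that of the twisted algebra at `D'`.
-/

noncomputable section

section GradedLie

variable {R L H : Type*} [CommRing R] [AddCommGroup L] [Module R L] [AddCommGroup H] [Module R H]

/-- A graded Lie bracket on the graded module with homogeneous parts `𝒢 i`: a bilinear map of
degree `0` which is graded antisymmetric and satisfies the graded Jacobi identity, the latter in
the form "`b x` is a derivation". -/
structure IsGradedLieBracket (𝒢 : ℤ → Submodule R L) (b : L →ₗ[R] L →ₗ[R] L) : Prop where
  mem : ∀ {i j x y}, x ∈ 𝒢 i → y ∈ 𝒢 j → b x y ∈ 𝒢 (i + j)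
  antisymm : ∀ {i j x y}, x ∈ 𝒢 i → y ∈ 𝒢 j → b x y = -((i * j).negOnePow • b y x)
  jacobi : ∀ {i j k x y z}, x ∈ 𝒢 i → y ∈ 𝒢 j → z ∈ 𝒢 k →
    b x (b y z) = b (b x y) z + (i * j).negOnePow • b y (b x z)

/-- A curved differential graded Lie algebra in the shifted convention, in which the curvature `c`,
the differential `δ` and the bracket `m` all have degree `1` and `m` is graded symmetric: the
generalized Jacobi identities of a curved `L_∞`-algebra with `l_k = 0` for `k ≥ 3`. -/
structure IsShiftedCurvedDGLie (𝒢 : ℤ → Submodule R L) (c : L) (δ : L →ₗ[R] L)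
    (m : L →ₗ[R] L →ₗ[R] L) : Prop where
  curvature_mem : c ∈ 𝒢 1
  differential_mem : ∀ {i x}, x ∈ 𝒢 i → δ x ∈ 𝒢 (i + 1)
  bracket_mem : ∀ {i j x y}, x ∈ 𝒢 i → y ∈ 𝒢 j → m x y ∈ 𝒢 (i + j + 1)
  symm : ∀ {i j x y}, x ∈ 𝒢 i → y ∈ 𝒢 j → m x y = (i * j).negOnePow • m y x
  differential_curvature : δ c = 0
  differential_square : ∀ {i x}, x ∈ 𝒢 i → m c x + δ (δ x) = 0
  leibniz : ∀ {i j x y}, x ∈ 𝒢 i → y ∈ 𝒢 j →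
    δ (m x y) + m (δ x) y + (i * j).negOnePow • m (δ y) x = 0
  jacobi : ∀ {i j k x y z}, x ∈ 𝒢 i → y ∈ 𝒢 j → z ∈ 𝒢 k →
    m (m x y) z + (j * k).negOnePow • m (m x z) y + (i * (j + k)).negOnePow • m (m y z) x = 0

namespace IsGradedLieBracket

variable {𝒢 : ℤ → Submodule R L} {b : L →ₗ[R] L →ₗ[R] L} (hb : IsGradedLieBracket 𝒢 b)
  {i j k : ℤ} {p φ x y z : L}
include hb

theorem symm_of_degree_one (hx : x ∈ 𝒢 1) (hy : y ∈ 𝒢 1) : b x y = b y x := by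
  simpa using hb.antisymm hx hy

theorem two_smul_bracket_bracket (hφ : φ ∈ 𝒢 1) (hx : x ∈ 𝒢 i) :
    (2 : R) • b φ (b φ x) = b (b φ φ) x := by
  have h := hb.jacobi hφ hφ hx
  rw [mul_one, Int.negOnePow_one, Units.neg_smul, one_smul, ← sub_eq_add_neg] at h
  rw [two_smul, ← eq_sub_iff_add_eq, ← h]

theorem bracket_bracket_eq_zero (h2 : IsSMulRegular L (2 : R)) (hφ : φ ∈ 𝒢 1) (h : b φ φ = 0)
    (hx : x ∈ 𝒢 i) : b φ (b φ x) = 0 := by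
  refine h2.right_eq_zero_of_smul ?_
  rw [hb.two_smul_bracket_bracket hφ hx, h, map_zero, LinearMap.zero_apply]

theorem derived_symm (hφ : φ ∈ 𝒢 1) (hx : x ∈ 𝒢 i) (hy : y ∈ 𝒢 j) (hxy : b x y = 0) :
    b (b φ x) y = (i * j).negOnePow • b (b φ y) x := by
  have hsign : (1 * i + i * (1 + j)).negOnePow = (i * j).negOnePow :=
    (Int.negOnePow_eq_iff _ _).2 ⟨i, by ring⟩
  have h := hb.jacobi hφ hx hy
  rw [hxy, map_zero] at h
  calc b (b φ x) y = -((1 * i).negOnePow • b x (b φ y)) := eq_neg_of_add_eq_zero_left h.symm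
    _ = (1 * i).negOnePow • (i * (1 + j)).negOnePow • b (b φ y) x := by
      rw [hb.antisymm hx (hb.mem hφ hy), smul_neg, neg_neg]
    _ = (i * j).negOnePow • b (b φ y) x := by rw [smul_smul, ← Int.negOnePow_add, hsign]

theorem derived_leibniz (hp : p ∈ 𝒢 1) (hφ : φ ∈ 𝒢 1) (hpφ : b p φ = 0) (hx : x ∈ 𝒢 i)
    (hy : y ∈ 𝒢 j) (hxy : b x (b p y) = 0) :
    b p (b (b φ x) y) + b (b φ (b p x)) y + (i * j).negOnePow • b (b φ (b p y)) x = 0 := by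
  have hsign : (1 * (1 + i) + i * (1 + j)).negOnePow = -(i * j).negOnePow := by
    rw [← Int.negOnePow_succ, Int.negOnePow_eq_iff]
    exact ⟨i, by ring⟩
  have hpx : b p (b φ x) = -b φ (b p x) := by
    rw [hb.jacobi hp hφ hx, hpφ, map_zero, LinearMap.zero_apply, zero_add, mul_one,
      Int.negOnePow_one, Units.neg_smul, one_smul]
  rw [hb.jacobi hp (hb.mem hφ hx) hy, hpx, hb.derived_symm hφ hx (hb.mem hp hy) hxy, smul_smul,
    ← Int.negOnePow_add, hsign, map_neg, LinearMap.neg_apply, Units.neg_smul]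
  abel

theorem derived_jacobi (h2 : IsSMulRegular L (2 : R)) (hφ : φ ∈ 𝒢 1) (h : b φ φ = 0)
    (hx : x ∈ 𝒢 i) (hy : y ∈ 𝒢 j) (hz : z ∈ 𝒢 k) (hxz : b x (b (b φ y) z) = 0)
    (hyz : b y (b (b φ x) z) = 0) :
    b (b φ (b (b φ x) y)) z + (j * k).negOnePow • b (b φ (b (b φ x) z)) y +
      (i * (j + k)).negOnePow • b (b φ (b (b φ y) z)) x = 0 := by
  have hsign₁ : (1 * (1 + i) + (1 + i) * (1 + j) + j * (1 + i + k)).negOnePow =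
      (j * k).negOnePow :=
    (Int.negOnePow_eq_iff _ _).2 ⟨1 + i + j + i * j, by ring⟩
  have hsign₂ : (1 * (1 + i) + i * (1 + j + k)).negOnePow = -(i * (j + k)).negOnePow := by
    rw [← Int.negOnePow_succ, Int.negOnePow_eq_iff]
    exact ⟨i, by ring⟩
  have hφx : b φ (b (b φ x) y) = (1 * (1 + i)).negOnePow • b (b φ x) (b φ y) := by
    rw [hb.jacobi hφ (hb.mem hφ hx) hy, hb.bracket_bracket_eq_zero h2 hφ h hx, map_zero,
      LinearMap.zero_apply, zero_add]
  have hxy : b (b (b φ x) (b φ y)) z = (i * (1 + j + k)).negOnePow • b (b φ (b (b φ y) z)) x -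
      ((1 + i) * (1 + j)).negOnePow • (j * (1 + i + k)).negOnePow • b (b φ (b (b φ x) z)) y := by
    rw [← hb.derived_symm hφ hx (hb.mem (hb.mem hφ hy) hz) hxz,
      ← hb.derived_symm hφ hy (hb.mem (hb.mem hφ hx) hz) hyz,
      hb.jacobi (hb.mem hφ hx) (hb.mem hφ hy) hz, add_sub_cancel_right]
  rw [hφx, LinearMap.map_smul_of_tower, LinearMap.smul_apply, hxy, smul_sub, smul_smul, smul_smul,
    smul_smul, ← Int.negOnePow_add, ← Int.negOnePow_add, ← Int.negOnePow_add, hsign₁, hsign₂,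
    Units.neg_smul]
  abel

/-- Voronov's derived bracket construction: up to factors `2`, the last four hypotheses are
components of `[ι c + p + q, ι c + p + q] = 0`. -/
theorem isShiftedCurvedDGLie (h2 : IsSMulRegular L (2 : R)) {ℋ : ℤ → Submodule R H}
    {ι : H →ₗ[R] L} (hι : Function.Injective ι) (hℋ : ∀ {i x}, ι x ∈ 𝒢 i ↔ x ∈ ℋ i)
    (hab : ∀ x y, b (ι x) (ι y) = 0) {q : L} {c : H} {δ : H →ₗ[R] H} {m : H →ₗ[R] H →ₗ[R] H}
    (hδ : ∀ x, ι (δ x) = b p (ι x)) (hm : ∀ x y, ι (m x y) = b (b q (ι x)) (ι y))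
    (hp : p ∈ 𝒢 1) (hq : q ∈ 𝒢 1) (hc : c ∈ ℋ 1) (hpc : b p (ι c) = 0)
    (hppqc : b p p + (2 : R) • b q (ι c) = 0) (hpq : b p q = 0) (hqq : b q q = 0) :
    IsShiftedCurvedDGLie ℋ c δ m where
  curvature_mem := hc
  differential_mem {i x} hx := by
    rw [← hℋ, hδ, add_comm]
    exact hb.mem hp (hℋ.2 hx)
  bracket_mem {i j x y} hx hy := by
    rw [← hℋ, hm, add_comm, ← add_assoc]
    exact hb.mem (hb.mem hq (hℋ.2 hx)) (hℋ.2 hy)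
  symm {i j x y} hx hy := hι <| by
    rw [LinearMap.map_smul_of_tower, hm, hm]
    exact hb.derived_symm hq (hℋ.2 hx) (hℋ.2 hy) (hab x y)
  differential_curvature := hι <| by rw [hδ, hpc, map_zero]
  differential_square {i x} hx := hι <| h2 <| by
    simp only [map_add, hδ, hm, map_zero, smul_add, smul_zero]
    rw [hb.two_smul_bracket_bracket hp (hℋ.2 hx), ← LinearMap.smul_apply, ← map_smul,
      ← LinearMap.add_apply, ← map_add, add_comm, hppqc, map_zero, LinearMap.zero_apply]
  leibniz {i j x y} hx hy := hι <| by
    simp only [map_add, LinearMap.map_smul_of_tower, hδ, hm, map_zero]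
    exact hb.derived_leibniz hp hq hpq (hℋ.2 hx) (hℋ.2 hy) (hδ y ▸ hab x _)
  jacobi {i j k x y z} hx hy hz := hι <| by
    simp only [map_add, LinearMap.map_smul_of_tower, hm, map_zero]
    exact hb.derived_jacobi h2 hq hqq (hℋ.2 hx) (hℋ.2 hy) (hℋ.2 hz) (hm y z ▸ hab x _)
      (hm x z ▸ hab y _)

end IsGradedLieBracket

end GradedLie

namespace IsShiftedCurvedDGLie

variable {K V : Type*} [Field K] [AddCommGroup V] [Module K V] {𝒢 : ℤ → Submodule K V} {c x y : V}
  {δ : V →ₗ[K] V} {m : V →ₗ[K] V →ₗ[K] V}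

theorem twist (h : IsShiftedCurvedDGLie 𝒢 c δ m) (hK : (2 : K) ≠ 0) (hx : x ∈ 𝒢 0)
    (hMC : c + δ x + (2⁻¹ : K) • m x x = 0) : IsShiftedCurvedDGLie 𝒢 0 (δ + m x) m where
  curvature_mem := zero_mem _
  differential_mem {i y} hy :=
    add_mem (h.differential_mem hy) (zero_add i ▸ h.bracket_mem hx hy)
  bracket_mem := h.bracket_mem
  symm := h.symm
  differential_curvature := map_zero _
  differential_square {i y} hy := by
    have hδ := h.differential_square hy
    have hleib := h.leibniz hx hy
    have hjac := h.jacobi hx hx hy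
    have hsymm := h.symm (h.differential_mem hy) hx
    have hsymm' := h.symm (h.bracket_mem hx hy) hx
    have hMCy : m (c + δ x + (2⁻¹ : K) • m x x) y = 0 := by
      rw [hMC, map_zero, LinearMap.zero_apply]
    simp only [zero_mul, mul_zero, Int.negOnePow_zero, one_smul, zero_add, map_add, map_smul,
      map_zero, LinearMap.add_apply, LinearMap.smul_apply, LinearMap.zero_apply] at *
    rw [hsymm] at hleib
    rw [hsymm'] at hjac
    linear_combination (norm := skip) hδ + hleib + (2⁻¹ : K) • hjac - hMCy
    match_scalars <;> field_simp <;> ring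
  leibniz {i j y z} hy hz := by
    have hleib := h.leibniz hy hz
    have hjac := h.jacobi hx hy hz
    have hsymm := h.symm (h.bracket_mem hy hz) hx
    simp only [mul_zero, zero_mul, Int.negOnePow_zero, one_smul] at hjac hsymm
    rw [hsymm] at hjac
    simp only [map_add, LinearMap.add_apply, Units.smul_def] at hleib hjac ⊢
    linear_combination (norm := module) hleib + hjac
  jacobi := h.jacobi

end IsShiftedCurvedDGLie

section MaurerCartan

variable {K V : Type*} [Field K] [AddCommGroup V] [Module K V] {c x y : V} {δ : V →ₗ[K] V}
  {m : V →ₗ[K] V →ₗ[K] V}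

theorem maurerCartan_add_iff (hK : (2 : K) ≠ 0) (hMC : c + δ x + (2⁻¹ : K) • m x x = 0)
    (hxy : m x y = m y x) :
    c + δ (x + y) + (2⁻¹ : K) • m (x + y) (x + y) = 0 ↔
      (δ + m x) y + (2⁻¹ : K) • m y y = 0 := by
  have hadd : c + δ (x + y) + (2⁻¹ : K) • m (x + y) (x + y) =
      (c + δ x + (2⁻¹ : K) • m x x) + ((δ + m x) y + (2⁻¹ : K) • m y y) := by
    simp only [map_add, LinearMap.add_apply, ← hxy]
    match_scalars <;> field_simp
    norm_num
  rw [hadd, hMC, zero_add]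

end MaurerCartan

section Shuffles

theorem koszulSign_one {n : ℕ} (d : Fin n → ℤ) : koszulSign d 1 = 1 := by
  rw [koszulSign, Finset.filter_false_of_mem, Finset.prod_empty]
  rintro p - ⟨h, h'⟩
  exact absurd h (not_lt.mpr h'.le)

theorem koszulSign_swap_fin_two (d : Fin 2 → ℤ) :
    koszulSign d (Equiv.swap 0 1) = (d 0 * d 1).negOnePow := by
  rw [koszulSign, show Finset.univ.filter (fun p : Fin 2 × Fin 2 => p.1 < p.2 ∧
    Equiv.swap (0 : Fin 2) 1 p.2 < Equiv.swap (0 : Fin 2) 1 p.1) = {(0, 1)} by decide,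
    Finset.prod_singleton, mul_comm]
  rfl

theorem koszulSign_swap_fin_three (d : Fin 3 → ℤ) :
    koszulSign d (Equiv.swap 1 2) = (d 1 * d 2).negOnePow := by
  rw [koszulSign, show Finset.univ.filter (fun p : Fin 3 × Fin 3 => p.1 < p.2 ∧
    Equiv.swap (1 : Fin 3) 2 p.2 < Equiv.swap (1 : Fin 3) 2 p.1) = {(1, 2)} by decide,
    Finset.prod_singleton, mul_comm]
  rfl

theorem koszulSign_finRotate_three (d : Fin 3 → ℤ) :
    koszulSign d (finRotate 3) = (d 0 * (d 1 + d 2)).negOnePow := by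
  rw [koszulSign, show Finset.univ.filter (fun p : Fin 3 × Fin 3 => p.1 < p.2 ∧
    finRotate 3 p.2 < finRotate 3 p.1) = {(0, 2), (1, 2)} by decide,
    Finset.prod_pair (by decide), mul_comm (d 0), add_mul, Int.negOnePow_add]
  rfl

theorem filter_isShuffle_eq {n i : ℕ} {s : Finset (Equiv.Perm (Fin n))}
    [DecidablePred fun σ : Equiv.Perm (Fin n) => IsShuffle i σ] (h : ∀ σ, IsShuffle i σ ↔ σ ∈ s) :
    Finset.univ.filter (fun σ => IsShuffle i σ) = s := by
  ext σ
  rw [Finset.mem_filter_univ, h]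

theorem isShuffle_fin_two_one (σ : Equiv.Perm (Fin 2)) :
    IsShuffle 1 σ ↔ σ ∈ ({1, Equiv.swap 0 1} : Finset (Equiv.Perm (Fin 2))) := by
  revert σ
  unfold IsShuffle
  decide

theorem isShuffle_fin_two_two (σ : Equiv.Perm (Fin 2)) :
    IsShuffle 2 σ ↔ σ ∈ ({1} : Finset (Equiv.Perm (Fin 2))) := by
  revert σ
  unfold IsShuffle
  decide

theorem isShuffle_fin_three_two (σ : Equiv.Perm (Fin 3)) :
    IsShuffle 2 σ ↔ σ ∈ ({1, Equiv.swap 1 2, finRotate 3} : Finset (Equiv.Perm (Fin 3))) := by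
  revert σ
  unfold IsShuffle
  decide

end Shuffles

section CurvedOperations

variable {K V : Type*} [Field K] [AddCommGroup V] [Module K V]

/-- The family of operations `l₀ = c`, `l₁ = δ`, `l₂ = m` and `l_k = 0` for `k ≥ 3`. -/
def curvedOperations (c : V) (δ : V →ₗ[K] V) (m : V →ₗ[K] V →ₗ[K] V) :
    ∀ k : ℕ, MultilinearMap K (fun _ : Fin k => V) V
  | 0 => MultilinearMap.constOfIsEmpty K _ c
  | 1 => MultilinearMap.ofSubsingleton K _ _ (0 : Fin 1) δ
  | 2 => bilinToMultilinear m
  | _ + 3 => 0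

variable {𝒢 : ℤ → Submodule K V} {c x : V} {δ : V →ₗ[K] V} {m : V →ₗ[K] V →ₗ[K] V}

theorem curvedOperations_of_three_le : ∀ {k : ℕ}, 3 ≤ k → curvedOperations c δ m k = 0
  | _ + 3, _ => rfl

namespace IsShiftedCurvedDGLie

variable (h : IsShiftedCurvedDGLie 𝒢 c δ m)
include h

theorem curvedOperations_mem (k : ℕ) (d : Fin k → ℤ) (x : Fin k → V) (hx : ∀ i, x i ∈ 𝒢 (d i)) :
    curvedOperations c δ m k x ∈ 𝒢 (∑ i, d i + 1) := by
  match k with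
  | 0 => exact h.curvature_mem
  | 1 =>
    rw [Fin.sum_univ_one]
    exact h.differential_mem (hx 0)
  | 2 =>
    rw [Fin.sum_univ_two]
    exact h.bracket_mem (hx 0) (hx 1)
  | k + 3 => exact zero_mem _

theorem curvedOperations_graded_symm (n : ℕ) (d : Fin n → ℤ) (x : Fin n → V)
    (hx : ∀ i, x i ∈ 𝒢 (d i)) (σ : Equiv.Perm (Fin n)) :
    curvedOperations c δ m n (fun a => x (σ a)) = koszulSign d σ • curvedOperations c δ m n x := by
  match n with
  | 0 | 1 =>
    rw [Subsingleton.elim σ 1, koszulSign_one, one_smul]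
    rfl
  | 2 =>
    have hσ : ∀ σ : Equiv.Perm (Fin 2), σ = 1 ∨ σ = Equiv.swap 0 1 := by decide
    rcases hσ σ with rfl | rfl
    · rw [koszulSign_one, one_smul]
      rfl
    · rw [koszulSign_swap_fin_two, mul_comm]
      exact h.symm (hx 1) (hx 0)
  | n + 3 => exact (smul_zero _).symm

open scoped Classical in
theorem sum_isShuffle_fin_one {d : Fin 1 → ℤ} {x : Fin 1 → V} (hx : ∀ i, x i ∈ 𝒢 (d i)) :
    ∑ σ ∈ Finset.univ.filter (fun σ : Equiv.Perm (Fin 1) => IsShuffle 0 σ),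
        koszulSign d σ • m c (x (σ 0)) +
      ∑ σ ∈ Finset.univ.filter (fun σ : Equiv.Perm (Fin 1) => IsShuffle 1 σ),
        koszulSign d σ • δ (δ (x (σ 0))) = 0 := by
  have hs (i) (σ : Equiv.Perm (Fin 1)) : IsShuffle i σ ↔ σ ∈ ({1} : Finset _) := by
    simp [Subsingleton.elim σ 1, IsShuffle]
  rw [filter_isShuffle_eq (hs 0), filter_isShuffle_eq (hs 1), Finset.sum_singleton,
    Finset.sum_singleton, ← smul_add, h.differential_square (hx _), smul_zero]

open scoped Classical in
theorem sum_isShuffle_fin_two {d : Fin 2 → ℤ} {x : Fin 2 → V} (hx : ∀ i, x i ∈ 𝒢 (d i)) :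
    ∑ σ ∈ Finset.univ.filter (fun σ : Equiv.Perm (Fin 2) => IsShuffle 1 σ),
        koszulSign d σ • m (δ (x (σ 0))) (x (σ 1)) +
      ∑ σ ∈ Finset.univ.filter (fun σ : Equiv.Perm (Fin 2) => IsShuffle 2 σ),
        koszulSign d σ • δ (m (x (σ 0)) (x (σ 1))) = 0 := by
  rw [filter_isShuffle_eq isShuffle_fin_two_one, filter_isShuffle_eq isShuffle_fin_two_two,
    Finset.sum_pair (by decide), Finset.sum_singleton, koszulSign_one, koszulSign_swap_fin_two,
    one_smul, one_smul, add_comm, ← add_assoc]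
  exact h.leibniz (hx 0) (hx 1)

open scoped Classical in
theorem sum_isShuffle_fin_three {d : Fin 3 → ℤ} {x : Fin 3 → V} (hx : ∀ i, x i ∈ 𝒢 (d i)) :
    ∑ σ ∈ Finset.univ.filter (fun σ : Equiv.Perm (Fin 3) => IsShuffle 2 σ),
      koszulSign d σ • m (m (x (σ 0)) (x (σ 1))) (x (σ 2)) = 0 := by
  rw [filter_isShuffle_eq isShuffle_fin_three_two, Finset.sum_insert (by decide),
    Finset.sum_pair (by decide), koszulSign_one, koszulSign_swap_fin_three,
    koszulSign_finRotate_three, one_smul, ← add_assoc]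
  exact h.jacobi (hx 0) (hx 1) (hx 2)

open scoped Classical in
theorem curvedOperations_jacobi (n : ℕ) (d : Fin n → ℤ) (x : Fin n → V)
    (hx : ∀ i, x i ∈ 𝒢 (d i)) :
    ∑ i : Fin (n + 1), ∑ σ ∈ Finset.univ.filter (fun σ : Equiv.Perm (Fin n) => IsShuffle i σ),
      koszulSign d σ •
        curvedOperations c δ m (n - i + 1)
          (Fin.cons (curvedOperations c δ m i (fun a : Fin i => x (σ ⟨a, by omega⟩)))
            (fun b : Fin (n - i) => x (σ ⟨i + b, by omega⟩))) = 0 := by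
  match n with
  | 0 =>
    rw [Fin.sum_univ_one]
    change ∑ σ ∈ Finset.univ.filter (fun σ : Equiv.Perm (Fin 0) => IsShuffle 0 σ),
      koszulSign d σ • δ c = 0
    simp only [h.differential_curvature, smul_zero, Finset.sum_const_zero]
  | 1 =>
    rw [Fin.sum_univ_two]
    exact h.sum_isShuffle_fin_one hx
  | 2 =>
    rw [Fin.sum_univ_three]
    change ∑ σ ∈ Finset.univ.filter (fun σ : Equiv.Perm (Fin 2) => IsShuffle 0 σ),
      koszulSign d σ • (0 : V) + _ + _ = 0
    rw [Finset.sum_eq_zero fun σ _ => smul_zero _, zero_add]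
    exact h.sum_isShuffle_fin_two hx
  | 3 =>
    rw [Fin.sum_univ_four]
    change ∑ σ ∈ Finset.univ.filter (fun σ : Equiv.Perm (Fin 3) => IsShuffle 0 σ),
        koszulSign d σ • (0 : V) +
      ∑ σ ∈ Finset.univ.filter (fun σ : Equiv.Perm (Fin 3) => IsShuffle 1 σ),
        koszulSign d σ • (0 : V) + _ +
      ∑ σ ∈ Finset.univ.filter (fun σ : Equiv.Perm (Fin 3) => IsShuffle 3 σ),
        koszulSign d σ • δ 0 = 0
    simp only [map_zero, smul_zero, Finset.sum_const_zero, zero_add, add_zero]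
    exact h.sum_isShuffle_fin_three hx
  | n + 4 =>
    refine Finset.sum_eq_zero fun i _ => Finset.sum_eq_zero fun σ _ => ?_
    rcases le_or_gt 3 (i : ℕ) with hi | hi
    · rw [curvedOperations_of_three_le hi]
      exact (congrArg _ (MultilinearMap.map_coord_zero _ 0 rfl)).trans (smul_zero _)
    · rw [curvedOperations_of_three_le (show 3 ≤ n + 4 - i + 1 by omega)]
      exact smul_zero _

theorem isCurvedLInfinityAlgebra (h𝒢 : DirectSum.IsInternal 𝒢) :
    IsCurvedLInfinityAlgebra 𝒢 (curvedOperations c δ m) where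
  isInternal := h𝒢
  degree_one := h.curvedOperations_mem
  graded_symm := h.curvedOperations_graded_symm
  jacobi := h.curvedOperations_jacobi

end IsShiftedCurvedDGLie

theorem finsum_eq_sum_range_three {M : Type*} [AddCommMonoid M] {f : ℕ → M}
    (hf : ∀ k, 3 ≤ k → f k = 0) :
    ∑ᶠ k, f k = f 0 + f 1 + f 2 := by
  rw [finsum_eq_sum_of_support_subset f (s := Finset.range 3), Finset.sum_range_succ,
    Finset.sum_range_succ, Finset.sum_range_one]
  intro k hk
  by_contra hk'
  exact hk (hf k (by simpa using hk'))

theorem twist_curvedOperations (c x : V) (δ : V →ₗ[K] V) (m : V →ₗ[K] V →ₗ[K] V) :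
    twist (curvedOperations c δ m) x = curvedOperations 0 (δ + m x) m := by
  funext k
  cases k with
  | zero => rfl
  | succ k =>
    have hzero (n : ℕ) (hn : 3 ≤ n) : ((n.factorial : K)⁻¹) •
        ((curvedOperations c δ m (n + (k + 1))).domDomCongr finSumFinEquiv.symm).currySum
          (fun _ : Fin n => x) = 0 := by
      rw [curvedOperations_of_three_le (by omega)]
      exact smul_zero _
    rw [twist, finsum_eq_sum_range_three hzero]
    ext v
    simp only [Nat.factorial, Nat.cast_one, inv_one, one_smul, mul_one, add_apply, smul_apply]
    match k with
    | 0 =>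
      change δ (v 0) + m x (v 0) + (_ : K) • (0 : V) = _
      rw [smul_zero, add_zero]
      rfl
    | 1 =>
      change m (v 0) (v 1) + 0 + (_ : K) • (0 : V) = _
      rw [smul_zero, add_zero, add_zero]
      rfl
    | k + 2 =>
      change 0 + 0 + (_ : K) • (0 : V) = _
      rw [smul_zero, add_zero, add_zero]
      rfl

theorem isMaurerCartan_curvedOperations_iff :
    IsMaurerCartan 𝒢 (curvedOperations c δ m) x ↔
      x ∈ 𝒢 0 ∧ c + δ x + (2⁻¹ : K) • m x x = 0 := by
  have hzero (k : ℕ) (hk : 3 ≤ k) : curvedOperations c δ m k (fun _ => x) = 0 := by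
    rw [curvedOperations_of_three_le hk, zero_apply]
  have hfin : {k : ℕ | curvedOperations c δ m k (fun _ => x) ≠ 0}.Finite :=
    (Set.finite_lt_nat 3).subset fun k hk => not_le.1 (mt (hzero k) hk)
  have hsum : ∑ᶠ k : ℕ, ((k.factorial : K)⁻¹) • curvedOperations c δ m k (fun _ => x) =
      c + δ x + (2⁻¹ : K) • m x x := by
    rw [finsum_eq_sum_range_three fun k hk => by rw [hzero k hk, smul_zero]]
    simp only [Nat.factorial, Nat.cast_one, inv_one, one_smul, mul_one]
    rfl
  rw [IsMaurerCartan, hsum]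
  exact and_congr_right fun _ => and_iff_right hfin

end CurvedOperations

section Cochains

variable {K V N : Type*} [Field K] [AddCommGroup V] [Module K V] [AddCommGroup N] [Module K N]

/-- Evaluation of the component of degree `n` at the first `n + 1` terms of a sequence. Indexing
arguments by `ℕ` avoids all casts between `Fin (m + n + p + 1)` and `Fin (m + (n + p) + 1)`. -/
def evalSeq (n : ℕ) (x : ℕ → V) : Cochains K V N →ₗ[K] N where
  toFun F := F n (fun k => x k)
  map_add' _ _ := rfl
  map_smul' _ _ := rfl

theorem evalSeq_apply (n : ℕ) (x : ℕ → V) (F : Cochains K V N) :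
    evalSeq n x F = F n (fun k => x k) := rfl

theorem evalSeq_cochainOf (m n : ℕ) (f : Cochain K V N m) (x : ℕ → V) :
    evalSeq n x (cochainOf m f) = if m = n then f (fun k => x k) else 0 := by
  rw [evalSeq_apply, DirectSum.lof_eq_of]
  split_ifs with h
  · subst h
    rw [DirectSum.of_eq_same]
  · rw [DirectSum.of_eq_of_ne _ _ _ (Ne.symm h), zero_apply]

theorem evalSeq_eq_zero {n j : ℕ} {x : ℕ → V} (F : Cochains K V N) (hj : j ∈ Finset.range (n + 1))
    (hx : x j = 0) : evalSeq n x F = 0 :=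
  (F n).map_coord_zero ⟨j, Finset.mem_range.mp hj⟩ hx

theorem exists_seq_extension {α : Type*} {n : ℕ} (v : Fin (n + 1) → α) :
    ∃ x : ℕ → α, (fun k : Fin (n + 1) => x k) = v :=
  ⟨fun k => v (Fin.ofNat (n + 1) k), funext fun k => congrArg v (Fin.cast_val_eq_self k)⟩

theorem cochains_ext_seq {F G : Cochains K V N} (h : ∀ n x, evalSeq n x F = evalSeq n x G) :
    F = G := by
  refine DFinsupp.ext fun n => MultilinearMap.ext fun v => ?_
  obtain ⟨x, rfl⟩ := exists_seq_extension v
  exact h n x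

theorem cochainOf_mem_cochainDegree (n : ℕ) (f : Cochain K V N n) :
    cochainOf n f ∈ cochainDegree K V N n := by
  intro m hm
  rw [DirectSum.lof_eq_of, DirectSum.of_eq_of_ne]
  exact_mod_cast hm

theorem eq_zero_or_eq_cochainOf_of_mem_cochainDegree {i : ℤ} {F : Cochains K V N}
    (hF : F ∈ cochainDegree K V N i) :
    F = 0 ∨ ∃ (n : ℕ) (f : Cochain K V N n), i = n ∧ F = cochainOf n f := by
  by_cases hi : 0 ≤ i
  · lift i to ℕ using hi
    refine Or.inr ⟨i, F i, rfl, DFinsupp.ext fun m => ?_⟩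
    rw [DirectSum.lof_eq_of]
    by_cases h : m = i
    · subst h
      exact (DirectSum.of_eq_same m _).symm
    · rw [hF m (by exact_mod_cast h)]
      exact (DirectSum.of_eq_of_ne _ _ _ h).symm
  · exact Or.inl (DFinsupp.ext fun m => hF m (by omega))

theorem isInternal_cochainDegree : DirectSum.IsInternal (cochainDegree K V N) := by
  classical
  refine DirectSum.isInternal_submodule_of_iSupIndep_of_iSup_eq_top ?_ ?_
  · rw [iSupIndep_iff_finsetSum_eq_zero_imp_eq_zero]
    intro s F hF hsum i hi
    refine DFinsupp.ext fun n => ?_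
    by_cases hn : (n : ℤ) = i
    · have hsum_n : ∑ j ∈ s, F j n = 0 := by
        rw [← DirectSum.sum_apply, hsum, DirectSum.zero_apply]
      rwa [Finset.sum_eq_single_of_mem i hi fun j hj hji => hF j hj n (hn.trans_ne hji.symm)]
        at hsum_n
    · exact hF i hi n hn
  · rw [eq_top_iff]
    intro F _
    rw [← DirectSum.sum_support_of F]
    exact Submodule.sum_mem _ fun n _ =>
      Submodule.mem_iSup_of_mem (n : ℤ) (cochainOf_mem_cochainDegree n (F n))

end Cochains

section Gerstenhaber

variable {K V : Type*} [Field K] [AddCommGroup V] [Module K V] {m n p : ℕ}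

/-- The sequence `x₀, …, x_{i-1}, g(x_i, …, x_{i+n}), x_{i+n+1}, …`: the form of `insertArg` for
infinite argument lists. -/
def insertSeq {V : Type*} {n : ℕ} (g : (Fin (n + 1) → V) → V) (i : ℕ) (x : ℕ → V) (j : ℕ) : V :=
  if j < i then x j else if j = i then g (fun k => x (i + k)) else x (j + n)

theorem insertSeq_of_lt {V : Type*} {n i j : ℕ} (g : (Fin (n + 1) → V) → V) (x : ℕ → V)
    (h : j < i) : insertSeq g i x j = x j := if_pos h

theorem insertSeq_self {V : Type*} {n : ℕ} (g : (Fin (n + 1) → V) → V) (i : ℕ) (x : ℕ → V) :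
    insertSeq g i x i = g (fun k => x (i + k)) := by
  rw [insertSeq, if_neg (lt_irrefl i), if_pos rfl]

theorem insertSeq_of_gt {V : Type*} {n i j : ℕ} (g : (Fin (n + 1) → V) → V) (x : ℕ → V)
    (h : i < j) : insertSeq g i x j = x (j + n) := by
  rw [insertSeq, if_neg (by omega), if_neg (by omega)]

theorem insertSeq_comm {V : Type*} {n p i j : ℕ} (g : (Fin (n + 1) → V) → V)
    (h : (Fin (p + 1) → V) → V) (hij : j < i) (x : ℕ → V) :
    insertSeq g i (insertSeq h j x) = insertSeq h j (insertSeq g (i + p) x) := by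
  funext k
  rcases lt_trichotomy k j with hk | rfl | hk
  · simp only [insertSeq_of_lt _ _ hk, insertSeq_of_lt _ _ (hk.trans hij),
      insertSeq_of_lt _ _ (show k < i + p by omega)]
  · rw [insertSeq_of_lt _ _ hij, insertSeq_self, insertSeq_self]
    congr 1
    funext l
    rw [insertSeq_of_lt _ _ (by omega)]
  · rw [insertSeq_of_gt h (insertSeq g (i + p) x) hk]
    rcases lt_trichotomy k i with hki | rfl | hki
    · rw [insertSeq_of_lt _ _ hki, insertSeq_of_gt _ _ hk, insertSeq_of_lt _ _ (by omega)]
    · rw [insertSeq_self, insertSeq_self]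
      congr 1
      funext l
      rw [insertSeq_of_gt _ _ (by omega), add_right_comm]
    · rw [insertSeq_of_gt _ _ hki, insertSeq_of_gt _ _ (by omega), insertSeq_of_gt _ _ (by omega),
        add_right_comm]

theorem insertion_seq (f : Cochain K V V m) (g : Cochain K V V n) (i : Fin (m + 1)) (x : ℕ → V) :
    insertion f g i (fun k => x k) = f (fun k => insertSeq g i x k) := by
  rw [insertion_apply]
  congr 1
  funext k
  simp only [insertArg, insertSeq, Fin.lt_def, Fin.ext_iff]

theorem insertSeq_insertSeq_add (g : Cochain K V V n) (h : Cochain K V V p) (i : ℕ)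
    (j : Fin (n + 1)) (x : ℕ → V) :
    insertSeq g i (insertSeq h (i + j) x) = insertSeq (insertion g h j) i x := by
  funext k
  rcases lt_trichotomy k i with hk | rfl | hk
  · simp only [insertSeq_of_lt _ _ hk, insertSeq_of_lt _ _ (show k < i + j by omega)]
  · have hshift : (fun l : Fin (n + 1) => insertSeq h (k + j) x (k + l)) =
        fun l : Fin (n + 1) => insertSeq h j (fun r => x (k + r)) l := by
      funext l
      simp only [insertSeq, add_lt_add_iff_left, Nat.add_left_cancel_iff, add_assoc]
    rw [insertSeq_self, insertSeq_self, hshift, ← insertion_seq]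
  · rw [insertSeq_of_gt _ _ hk, insertSeq_of_gt _ _ hk, insertSeq_of_gt _ _ (by omega), add_assoc]

theorem gerstenhaberComp_seq (f : Cochain K V V m) (g : Cochain K V V n) (x : ℕ → V) :
    gerstenhaberComp m n f g (fun k => x k) =
      ∑ i ∈ Finset.range (m + 1), (-1 : K) ^ (i * n) • f (fun k => insertSeq g i x k) := by
  rw [Finset.sum_range]
  simp only [gerstenhaberComp, LinearMap.sum_apply, sum_apply, LinearMap.smul_apply,
    smul_apply, ← insertion_seq]
  rfl

theorem gerstenhaberComp_comp_seq (f : Cochain K V V m) (g : Cochain K V V n)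
    (h : Cochain K V V p) (x : ℕ → V) :
    gerstenhaberComp m (n + p) f (gerstenhaberComp n p g h) (fun k => x k) =
      ∑ i ∈ Finset.range (m + 1), ∑ j ∈ Finset.Ico i (i + n + 1),
        (-1 : K) ^ (i * n + j * p) • f (fun k => insertSeq g i (insertSeq h j x) k) := by
  have hinsert (i : Fin (m + 1)) (j : Fin (n + 1)) :
      insertionₗ m (n + p) i f (insertionₗ n p j g h) (fun k => x k) =
        f (fun k => insertSeq g i (insertSeq h (i + j) x) k) := by
    rw [insertSeq_insertSeq_add]
    exact insertion_seq f (insertion g h j) i x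
  simp only [Finset.sum_Ico_eq_sum_range, add_assoc, add_tsub_cancel_left, Finset.sum_range,
    gerstenhaberComp, LinearMap.sum_apply, sum_apply, LinearMap.smul_apply, smul_apply, map_sum,
    map_smul, Finset.smul_sum]
  rw [Finset.sum_comm]
  refine Finset.sum_congr rfl fun i _ => Finset.sum_congr rfl fun j _ => ?_
  rw [smul_smul, ← pow_add]
  convert congrArg _ (hinsert i j) using 3
  ring

end Gerstenhaber

section GerstenhaberLie

variable {K V : Type*} [Field K] [AddCommGroup V] [Module K V] {m n p : ℕ}

/-- The terms `f(…, h(…), …, g(…), …)` of `(f ∘ g) ∘ h` in which `h` is inserted to the left of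
`g`. These and the terms of `f ∘ (g ∘ h)` make up `(f ∘ g) ∘ h`, up to the terms with `g` to the
left of `h`. -/
def gerstenhaberCompLeft (f : Cochain K V V m) (g : Cochain K V V n) (h : Cochain K V V p)
    (x : ℕ → V) : V :=
  ∑ i ∈ Finset.range (m + 1), ∑ j ∈ Finset.range i,
    (-1 : K) ^ (i * n + j * p) • f (fun k => insertSeq g i (insertSeq h j x) k)

theorem neg_one_pow_smul_gerstenhaberCompLeft (f : Cochain K V V m) (g : Cochain K V V n)
    (h : Cochain K V V p) (x : ℕ → V) :
    (-1 : K) ^ (n * p) • gerstenhaberCompLeft f h g x =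
      ∑ i ∈ Finset.range (m + 1), ∑ j ∈ Finset.Ico (i + n + 1) (m + n + 1),
        (-1 : K) ^ (i * n + j * p) • f (fun k => insertSeq g i (insertSeq h j x) k) := by
  have hshift (i : ℕ) : ∑ j ∈ Finset.Ico (i + n + 1) (m + n + 1),
      (-1 : K) ^ (i * n + j * p) • f (fun k => insertSeq g i (insertSeq h j x) k) =
      ∑ j ∈ Finset.Ico (i + 1) (m + 1), (-1 : K) ^ (n * p) • (-1 : K) ^ (j * p + i * n) •
        f (fun k => insertSeq h j (insertSeq g i x) k) := by
    rw [add_right_comm i n 1, add_right_comm m n 1, ← Finset.sum_Ico_add']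
    refine Finset.sum_congr rfl fun j hj => ?_
    rw [insertSeq_comm h g (Finset.mem_Ico.mp hj).1, smul_smul, ← pow_add]
    congr 2
    ring
  simp only [hshift, gerstenhaberCompLeft, Finset.smul_sum, Finset.range_eq_Ico]
  exact (Finset.sum_Ico_Ico_comm' 0 (m + 1) fun i j => (-1 : K) ^ (n * p) •
    (-1 : K) ^ (j * p + i * n) • f (fun k => insertSeq h j (insertSeq g i x) k)).symm

theorem gerstenhaberComp_assoc_seq (f : Cochain K V V m) (g : Cochain K V V n)
    (h : Cochain K V V p) (x : ℕ → V) :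
    gerstenhaberComp (m + n) p (gerstenhaberComp m n f g) h (fun k => x k) =
      gerstenhaberComp m (n + p) f (gerstenhaberComp n p g h) (fun k => x k) +
        (gerstenhaberCompLeft f g h x + (-1 : K) ^ (n * p) • gerstenhaberCompLeft f h g x) := by
  rw [gerstenhaberComp_comp_seq, gerstenhaberComp_seq, neg_one_pow_smul_gerstenhaberCompLeft,
    gerstenhaberCompLeft]
  simp only [gerstenhaberComp_seq, Finset.smul_sum, smul_smul, ← pow_add]
  rw [Finset.sum_comm, ← Finset.sum_add_distrib, ← Finset.sum_add_distrib]
  refine Finset.sum_congr rfl fun i hi => ?_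
  have him : i < m + 1 := Finset.mem_range.mp hi
  rw [Finset.range_eq_Ico, Finset.range_eq_Ico,
    ← Finset.sum_Ico_consecutive _ (Nat.zero_le i) (by omega : i ≤ m + n + 1),
    ← Finset.sum_Ico_consecutive _ (by omega : i ≤ i + n + 1) (by omega : i + n + 1 ≤ m + n + 1)]
  simp only [add_comm (_ * p) (i * n)]
  abel

theorem gerstenhaberBracket_cochainOf (f : Cochain K V V m) (g : Cochain K V V n) :
    gerstenhaberBracket (cochainOf m f) (cochainOf n g) =
      cochainOf (m + n) (gerstenhaberComp m n f g) -
        (-1 : K) ^ (m * n) • cochainOf (n + m) (gerstenhaberComp n m g f) := by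
  simp only [gerstenhaberBracket, cochainOf, DirectSum.toModule_lof, LinearMap.flip_apply,
    gerstenhaberBracketHom, LinearMap.sub_apply, LinearMap.smul_apply, LinearMap.compr₂_apply]

theorem gerstenhaberComp_preLie (f : Cochain K V V m) (g : Cochain K V V n)
    (h : Cochain K V V p) :
    cochainOf (m + n + p) (gerstenhaberComp (m + n) p (gerstenhaberComp m n f g) h) -
        cochainOf (m + (n + p)) (gerstenhaberComp m (n + p) f (gerstenhaberComp n p g h)) =
      (-1 : K) ^ (n * p) •
        (cochainOf (m + p + n) (gerstenhaberComp (m + p) n (gerstenhaberComp m p f h) g) -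
          cochainOf (m + (p + n)) (gerstenhaberComp m (p + n) f (gerstenhaberComp p n h g))) := by
  refine cochains_ext_seq fun N x => ?_
  simp only [map_sub, map_smul, evalSeq_cochainOf, add_right_comm m p n, add_comm p n,
    ← add_assoc m n p]
  split_ifs
  · have hfgh := gerstenhaberComp_assoc_seq f g h x
    have hfhg := gerstenhaberComp_assoc_seq f h g x
    rw [mul_comm p n] at hfhg
    have hsign : (-1 : K) ^ (n * p) * (-1) ^ (n * p) = 1 := by rw [← mul_pow]; norm_num
    generalize (-1 : K) ^ (n * p) = c at *
    linear_combination (norm := skip) hfgh - c • hfhg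
    match_scalars <;> grind only
  · rw [sub_zero, smul_zero]

theorem gerstenhaberBracket_cochainOf_antisymm (f : Cochain K V V m) (g : Cochain K V V n) :
    gerstenhaberBracket (cochainOf m f) (cochainOf n g) =
      -((-1 : K) ^ (m * n) • gerstenhaberBracket (cochainOf n g) (cochainOf m f)) := by
  rw [gerstenhaberBracket_cochainOf, gerstenhaberBracket_cochainOf, mul_comm n m]
  rcases neg_one_pow_eq_or K (m * n) with e | e <;> rw [e] <;> module

theorem gerstenhaberBracket_cochainOf_jacobi (f : Cochain K V V m) (g : Cochain K V V n)
    (h : Cochain K V V p) :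
    gerstenhaberBracket (cochainOf m f) (gerstenhaberBracket (cochainOf n g) (cochainOf p h)) =
      gerstenhaberBracket (gerstenhaberBracket (cochainOf m f) (cochainOf n g)) (cochainOf p h) +
        (-1 : K) ^ (m * n) • gerstenhaberBracket (cochainOf n g)
          (gerstenhaberBracket (cochainOf m f) (cochainOf p h)) := by
  have hf := gerstenhaberComp_preLie f g h
  have hg := gerstenhaberComp_preLie g f h
  have hh := gerstenhaberComp_preLie h f g
  have hmn : (-1 : K) ^ (m * n) * (-1) ^ (m * n) = 1 := by rw [← mul_pow]; norm_num
  have hmp : (-1 : K) ^ (m * p) * (-1) ^ (m * p) = 1 := by rw [← mul_pow]; norm_num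
  have hnp : (-1 : K) ^ (n * p) * (-1) ^ (n * p) = 1 := by rw [← mul_pow]; norm_num
  simp only [gerstenhaberBracket_cochainOf, map_sub, map_smul, LinearMap.sub_apply,
    LinearMap.smul_apply, mul_add, add_mul, pow_add, mul_comm n m]
    at hf hg hh ⊢
  generalize (-1 : K) ^ (m * n) = a at *
  generalize (-1 : K) ^ (m * p) = b at *
  generalize (-1 : K) ^ (n * p) = c at *
  linear_combination (norm := skip) -hf + a • hg - (b * c) • hh
  match_scalars <;> grind

theorem negOnePow_mul_smul {M : Type*} [AddCommGroup M] [Module K M] (m n : ℕ) (x : M) :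
    ((m : ℤ) * n).negOnePow • x = (-1 : K) ^ (m * n) • x := by
  rcases Nat.even_or_odd (m * n) with h | h
  · rw [h.neg_one_pow, Int.negOnePow_even _ (by exact_mod_cast h), one_smul, one_smul]
  · rw [h.neg_one_pow, Int.negOnePow_odd _ (by exact_mod_cast h), neg_smul, one_smul,
      Units.neg_smul, one_smul]

theorem isGradedLieBracket_gerstenhaberBracket :
    IsGradedLieBracket (cochainDegree K V V) gerstenhaberBracket where
  mem {i j x y} hx hy := by
    rcases eq_zero_or_eq_cochainOf_of_mem_cochainDegree hx with rfl | ⟨m, f, rfl, rfl⟩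
    · simp only [map_zero, LinearMap.zero_apply, zero_mem]
    rcases eq_zero_or_eq_cochainOf_of_mem_cochainDegree hy with rfl | ⟨n, g, rfl, rfl⟩
    · simp only [map_zero, zero_mem]
    rw [gerstenhaberBracket_cochainOf, ← Nat.cast_add]
    refine Submodule.sub_mem _ (cochainOf_mem_cochainDegree _ _) (Submodule.smul_mem _ _ ?_)
    rw [add_comm m n]
    exact cochainOf_mem_cochainDegree _ _
  antisymm {i j x y} hx hy := by
    rcases eq_zero_or_eq_cochainOf_of_mem_cochainDegree hx with rfl | ⟨m, f, rfl, rfl⟩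
    · simp only [map_zero, LinearMap.zero_apply, smul_zero, neg_zero]
    rcases eq_zero_or_eq_cochainOf_of_mem_cochainDegree hy with rfl | ⟨n, g, rfl, rfl⟩
    · simp only [map_zero, LinearMap.zero_apply, smul_zero, neg_zero]
    rw [negOnePow_mul_smul (K := K), gerstenhaberBracket_cochainOf_antisymm]
  jacobi {i j k x y z} hx hy hz := by
    rcases eq_zero_or_eq_cochainOf_of_mem_cochainDegree hx with rfl | ⟨m, f, rfl, rfl⟩
    · simp only [map_zero, LinearMap.zero_apply, smul_zero, add_zero]
    rcases eq_zero_or_eq_cochainOf_of_mem_cochainDegree hy with rfl | ⟨n, g, rfl, rfl⟩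
    · simp only [map_zero, LinearMap.zero_apply, smul_zero, add_zero]
    rcases eq_zero_or_eq_cochainOf_of_mem_cochainDegree hz with rfl | ⟨p, h, rfl, rfl⟩
    · simp only [map_zero, smul_zero, add_zero]
    rw [negOnePow_mul_smul (K := K), gerstenhaberBracket_cochainOf_jacobi]

end GerstenhaberLie

section Weight

variable {K V : Type*} [Field K] [AddCommGroup V] [Module K V] {𝓐 : ℤ → Submodule K V}

theorem cochains_ext_homogeneous {N : Type*} [AddCommGroup N] [Module K N] (h𝓐 : ⨆ i, 𝓐 i = ⊤)
    {F G : Cochains K V N}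
    (h : ∀ (n : ℕ) (d : ℕ → ℤ) (x : ℕ → V), (∀ j, x j ≠ 0 ∧ x j ∈ 𝓐 (d j)) →
      evalSeq n x F = evalSeq n x G) : F = G := by
  refine DFinsupp.ext fun n => ?_
  let S : Set V := (⋃ i, (𝓐 i : Set V)) \ {0}
  have hspan : Submodule.span K (Set.range ((↑) : S → V)) = ⊤ := by
    rw [Subtype.range_coe, Submodule.span_sdiff_singleton_zero, ← Submodule.iSup_eq_span, h𝓐]
  refine MultilinearMap.ext_of_span_eq_top (g := fun _ => ((↑) : S → V)) (fun _ => hspan)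
    fun v => ?_
  obtain ⟨x, rfl⟩ := exists_seq_extension v
  choose d hd using fun j => Set.mem_iUnion.mp (x j).2.1
  exact h n d (fun j => x j) fun j => ⟨(x j).2.2, hd j⟩

variable (𝓐) in
/-- The cochains of weight `w` with respect to a family of subspaces `𝓐 i`, regarded as the part of
`V` of degree `i`: those that raise the total degree by `w`. The weight is independent of the
degree in the sense of `cochainDegree`, which counts arguments. -/
def weight (w : ℤ) : Submodule K (Cochains K V V) where
  carrier := {F | ∀ (n : ℕ) (d : ℕ → ℤ) (x : ℕ → V), (∀ j, x j ∈ 𝓐 (d j)) →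
    evalSeq n x F ∈ 𝓐 (∑ j ∈ Finset.range (n + 1), d j + w)}
  add_mem' hF hG n d x hx := by
    rw [map_add]
    exact add_mem (hF n d x hx) (hG n d x hx)
  zero_mem' n d x _ := by
    rw [map_zero]
    exact zero_mem _
  smul_mem' c F hF n d x hx := by
    rw [map_smul]
    exact Submodule.smul_mem _ c (hF n d x hx)

theorem iSupIndep_weight (h𝓐 : DirectSum.IsInternal 𝓐) : iSupIndep (weight 𝓐) := by
  rw [iSupIndep_iff_finsetSum_eq_zero_imp_eq_zero]
  intro s F hF hsum w hw
  refine cochains_ext_homogeneous h𝓐.submodule_iSup_eq_top fun n d x hx => ?_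
  have hindep := h𝓐.submodule_iSupIndep.comp
    (add_right_injective (∑ j ∈ Finset.range (n + 1), d j))
  rw [iSupIndep_iff_finsetSum_eq_zero_imp_eq_zero] at hindep
  rw [map_zero]
  refine hindep s (fun w => evalSeq n x (F w)) (fun w hw => hF w hw n d x fun j => (hx j).2) ?_ w hw
  rw [← map_sum, hsum, map_zero]

theorem eq_zero_of_mem_weight_of_sum_eq_zero {ι : Type*} [Fintype ι] (h𝓐 : DirectSum.IsInternal 𝓐)
    {w : ι → ℤ} (hw : Function.Injective w) {F : ι → Cochains K V V}
    (hF : ∀ i, F i ∈ weight 𝓐 (w i)) (hsum : ∑ i, F i = 0) (i : ι) : F i = 0 :=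
  (iSupIndep_iff_finsetSum_eq_zero_imp_eq_zero _).mp ((iSupIndep_weight h𝓐).comp hw) Finset.univ F
    (fun i _ => hF i) hsum i (Finset.mem_univ i)

theorem cochainOf_mem_weight {w : ℤ} {n : ℕ} {f : Cochain K V V n} :
    cochainOf n f ∈ weight 𝓐 w ↔ ∀ (d : ℕ → ℤ) (x : ℕ → V), (∀ j, x j ∈ 𝓐 (d j)) →
      f (fun k => x k) ∈ 𝓐 (∑ j ∈ Finset.range (n + 1), d j + w) := by
  constructor
  · intro h d x hx
    simpa only [evalSeq_cochainOf, if_true] using h n d x hx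
  · intro h m d x hx
    rw [evalSeq_cochainOf]
    split_ifs with hm
    · exact hm ▸ h d x hx
    · exact zero_mem _

theorem sum_range_insert {M : Type*} [AddCommMonoid M] {m i : ℕ} (n : ℕ) (hi : i ≤ m) (d : ℕ → M)
    (b : M) :
    ∑ j ∈ Finset.range (m + 1), (if j < i then d j else if j = i then
      ∑ k ∈ Finset.range (n + 1), d (i + k) + b else d (j + n)) =
      ∑ j ∈ Finset.range (m + n + 1), d j + b := by
  obtain ⟨r, rfl⟩ := Nat.exists_eq_add_of_le hi
  have hlt : ∀ j ∈ Finset.range i, (if j < i then d j else if j = i then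
      ∑ k ∈ Finset.range (n + 1), d (i + k) + b else d (j + n)) = d j := fun j hj =>
    if_pos (Finset.mem_range.mp hj)
  have hgt : ∀ j ∈ Finset.range r, (if i + (1 + j) < i then d (i + (1 + j)) else
      if i + (1 + j) = i then ∑ k ∈ Finset.range (n + 1), d (i + k) + b else d (i + (1 + j) + n)) =
      d (i + (n + 1 + j)) := fun j _ => by
    rw [if_neg (by omega), if_neg (by omega)]
    congr 1
    omega
  rw [show i + r + n + 1 = i + (n + 1 + r) by omega, show i + r + 1 = i + (1 + r) by omega,
    Finset.sum_range_add, Finset.sum_range_add _ 1, Finset.sum_range_add _ i,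
    Finset.sum_range_add _ (n + 1), Finset.sum_congr rfl hlt, Finset.sum_congr rfl hgt]
  simp only [Finset.sum_range_one, add_zero, lt_irrefl, if_false, if_true]
  abel

theorem gerstenhaberComp_mem_weight {v w : ℤ} {m n : ℕ} {f : Cochain K V V m}
    {g : Cochain K V V n} (hf : cochainOf m f ∈ weight 𝓐 v) (hg : cochainOf n g ∈ weight 𝓐 w) :
    cochainOf (m + n) (gerstenhaberComp m n f g) ∈ weight 𝓐 (v + w) := by
  rw [cochainOf_mem_weight] at *
  intro d x hx
  rw [gerstenhaberComp_seq]
  refine Submodule.sum_mem _ fun i hi => Submodule.smul_mem _ _ ?_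
  have hinsert : ∀ j, insertSeq g i x j ∈ 𝓐 (if j < i then d j else if j = i then
      ∑ k ∈ Finset.range (n + 1), d (i + k) + w else d (j + n)) := fun j => by
    unfold insertSeq
    split_ifs
    · exact hx j
    · exact hg (fun k => d (i + k)) (fun k => x (i + k)) fun k => hx _
    · exact hx _
  have hmem := hf _ _ hinsert
  rwa [sum_range_insert n (Finset.mem_range_succ_iff.mp hi), add_assoc, add_comm w] at hmem

theorem gerstenhaberBracket_mem_weight {u v w : ℤ} {F G : Cochains K V V} (hF : F ∈ weight 𝓐 v)
    (hG : G ∈ weight 𝓐 w) (hu : v + w = u) : gerstenhaberBracket F G ∈ weight 𝓐 u := by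
  classical
  subst hu
  rw [← DirectSum.sum_support_of F, ← DirectSum.sum_support_of G, map_sum]
  refine Submodule.sum_mem _ fun n _ => ?_
  rw [map_sum, LinearMap.sum_apply]
  refine Submodule.sum_mem _ fun m _ => ?_
  have hf : cochainOf m (F m) ∈ weight 𝓐 v := cochainOf_mem_weight.mpr (hF m)
  have hg : cochainOf n (G n) ∈ weight 𝓐 w := cochainOf_mem_weight.mpr (hG n)
  have hbracket := Submodule.sub_mem _ (gerstenhaberComp_mem_weight hf hg)
    (Submodule.smul_mem _ ((-1 : K) ^ (m * n)) (add_comm w v ▸ gerstenhaberComp_mem_weight hg hf))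
  rwa [← gerstenhaberBracket_cochainOf] at hbracket

end Weight

section LinearBilinear

variable {K V N : Type*} [Field K] [AddCommGroup V] [Module K V] [AddCommGroup N] [Module K N]

theorem evalSeq_linCochain (n : ℕ) (x : ℕ → V) (E : V →ₗ[K] N) :
    evalSeq n x (linCochain E) = if 0 = n then E (x 0) else 0 := evalSeq_cochainOf ..

theorem evalSeq_bilinCochain (n : ℕ) (x : ℕ → V) (B : V →ₗ[K] V →ₗ[K] N) :
    evalSeq n x (bilinCochain B) = if 1 = n then B (x 0) (x 1) else 0 := evalSeq_cochainOf ..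

theorem linCochain_add (E E' : V →ₗ[K] N) :
    linCochain (E + E') = linCochain E + linCochain E' :=
  map_add ((cochainOf 0).comp (MultilinearMap.ofSubsingletonₗ K K V N (0 : Fin 1)).toLinearMap) E E'

theorem bilinCochain_add (B C : V →ₗ[K] V →ₗ[K] N) :
    bilinCochain (B + C) = bilinCochain B + bilinCochain C :=
  map_add (cochainOf 1) (bilinToMultilinear B) (bilinToMultilinear C)

theorem bilinCochain_smul (a : K) (B : V →ₗ[K] V →ₗ[K] N) :
    bilinCochain (a • B) = a • bilinCochain B :=
  map_smul (cochainOf 1) a (bilinToMultilinear B)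

theorem bilinCochain_eq_zero_iff {B : V →ₗ[K] V →ₗ[K] N} : bilinCochain B = 0 ↔ B = 0 := by
  refine ⟨fun h => LinearMap.ext₂ fun x y => ?_, ?_⟩
  · have hxy := evalSeq_bilinCochain 1 (fun n => if n = 0 then x else y) B
    rw [h, map_zero] at hxy
    exact hxy.symm
  · rintro rfl
    exact map_zero (cochainOf 1)

theorem linCochain_mem_cochainDegree (E : V →ₗ[K] N) : linCochain E ∈ cochainDegree K V N 0 :=
  cochainOf_mem_cochainDegree 0 _

theorem bilinCochain_mem_cochainDegree (B : V →ₗ[K] V →ₗ[K] N) :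
    bilinCochain B ∈ cochainDegree K V N 1 :=
  cochainOf_mem_cochainDegree 1 _

theorem bilinCochain_mem_weight {𝓐 : ℤ → Submodule K V} {w : ℤ} {B : V →ₗ[K] V →ₗ[K] V}
    (h : ∀ i j, ∀ x ∈ 𝓐 i, ∀ y ∈ 𝓐 j, B x y ∈ 𝓐 (i + j + w)) : bilinCochain B ∈ weight 𝓐 w := by
  rw [bilinCochain, cochainOf_mem_weight]
  intro d x hx
  rw [Finset.sum_range_succ, Finset.sum_range_one]
  exact h _ _ _ (hx 0) _ (hx 1)

theorem gerstenhaberBracket_bilinCochain_self (B : V →ₗ[K] V →ₗ[K] V)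
    (h : ∀ x y z, B (B x y) z = B x (B y z)) :
    gerstenhaberBracket (bilinCochain B) (bilinCochain B) = 0 := by
  have hcomp : cochainOf (1 + 1)
      (gerstenhaberComp 1 1 (bilinToMultilinear B) (bilinToMultilinear B)) = 0 := by
    refine cochains_ext_seq fun n x => ?_
    rw [evalSeq_cochainOf, gerstenhaberComp_seq, Finset.sum_range_succ, Finset.sum_range_one,
      zero_mul, pow_zero, one_smul, one_mul, pow_one, neg_one_smul, map_zero]
    have hassoc : B (B (x 0) (x 1)) (x 2) + -B (x 0) (B (x 1) (x 2)) = 0 := by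
      rw [h, add_neg_cancel]
    split_ifs
    · exact hassoc
    · rfl
  rw [bilinCochain, gerstenhaberBracket_cochainOf, hcomp, smul_zero, sub_zero]

theorem gerstenhaberBracket_bilinCochain_linCochain (B : V →ₗ[K] V →ₗ[K] V) (E : V →ₗ[K] V) :
    gerstenhaberBracket (bilinCochain B) (linCochain E) =
      bilinCochain (B.comp E + B.compl₂ E - B.compr₂ E) := by
  refine cochains_ext_seq fun n x => ?_
  rw [bilinCochain, linCochain, gerstenhaberBracket_cochainOf, map_sub, map_smul,
    evalSeq_cochainOf, evalSeq_cochainOf, evalSeq_bilinCochain, gerstenhaberComp_seq,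
    gerstenhaberComp_seq]
  simp only [Finset.sum_range_succ, Finset.sum_range_zero, zero_add, mul_zero, zero_mul, pow_zero,
    one_smul]
  change (if 1 = n then B (E (x 0)) (x 1) + B (x 0) (E (x 1)) else 0) -
    (if 1 = n then E (B (x 0) (x 1)) else 0) =
    if 1 = n then B (E (x 0)) (x 1) + B (x 0) (E (x 1)) - E (B (x 0) (x 1)) else 0
  split_ifs
  · rfl
  · exact sub_zero 0

end LinearBilinear

namespace QuasiTwilled

variable {K 𝒜 : Type*} [Field K] [NonUnitalRing 𝒜] [Module K 𝒜]
  [SMulCommClass K 𝒜 𝒜] [IsScalarTower K 𝒜 𝒜] (Q : QuasiTwilled K 𝒜)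

theorem pr_of_mem {x : 𝒜} (hx : x ∈ Q.A) : Q.pr x = ⟨x, hx⟩ :=
  Submodule.projectionOnto_apply_left Q.isCompl ⟨x, hx⟩

theorem pr_of_mem' {x : 𝒜} (hx : x ∈ Q.A') : Q.pr x = 0 :=
  (Submodule.projectionOnto_apply_eq_zero_iff Q.isCompl).mpr hx

theorem pr'_of_mem' {x : 𝒜} (hx : x ∈ Q.A') : Q.pr' x = ⟨x, hx⟩ :=
  Submodule.projectionOnto_apply_left Q.isCompl.symm ⟨x, hx⟩

theorem pr'_of_mem {x : 𝒜} (hx : x ∈ Q.A) : Q.pr' x = 0 :=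
  (Submodule.projectionOnto_apply_eq_zero_iff Q.isCompl.symm).mpr hx

theorem pr_coe (x : Q.A) : Q.pr x = x := Q.pr_of_mem x.2

theorem pr_coe' (u : Q.A') : Q.pr u = 0 := Q.pr_of_mem' u.2

theorem pr'_coe' (u : Q.A') : Q.pr' u = u := Q.pr'_of_mem' u.2

theorem pr'_coe (x : Q.A) : Q.pr' x = 0 := Q.pr'_of_mem x.2

theorem pr_add_pr' (x : 𝒜) : (Q.pr x : 𝒜) + Q.pr' x = x :=
  Submodule.projection_add_projection_eq_self Q.isCompl x

/-- The grading of `𝒜` with `A` in degree `0` and `A'` in degree `1`. -/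
def part (i : ℤ) : Submodule K 𝒜 := if i = 0 then Q.A else if i = 1 then Q.A' else ⊥

theorem part_zero : Q.part 0 = Q.A := if_pos rfl

theorem part_one : Q.part 1 = Q.A' := if_neg one_ne_zero

theorem part_eq_bot {i : ℤ} (h0 : i ≠ 0) (h1 : i ≠ 1) : Q.part i = ⊥ := by
  rw [part, if_neg h0, if_neg h1]

theorem mem_part_iff {i : ℤ} {x : 𝒜} :
    x ∈ Q.part i ↔ x = 0 ∨ i = 0 ∧ x ∈ Q.A ∨ i = 1 ∧ x ∈ Q.A' := by
  by_cases h0 : i = 0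
  · subst h0
    simpa [part_zero] using fun h : x = 0 => h ▸ zero_mem _
  · by_cases h1 : i = 1
    · subst h1
      simpa [part_one] using fun h : x = 0 => h ▸ zero_mem _
    · simp [Q.part_eq_bot h0 h1, h0, h1]

theorem isInternal_part : DirectSum.IsInternal Q.part := by
  refine DirectSum.isInternal_submodule_of_iSupIndep_of_iSup_eq_top
    (iSupIndep_def.mpr fun i => ?_) ?_
  · by_cases h0 : i = 0
    · subst h0
      rw [part_zero]
      refine Q.isCompl.disjoint.mono_right (iSup₂_le fun j hj x hx => ?_)
      rcases Q.mem_part_iff.mp hx with rfl | ⟨rfl, -⟩ | ⟨-, h⟩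
      · exact zero_mem _
      · exact absurd rfl hj
      · exact h
    by_cases h1 : i = 1
    · subst h1
      rw [part_one]
      refine Q.isCompl.symm.disjoint.mono_right (iSup₂_le fun j hj x hx => ?_)
      rcases Q.mem_part_iff.mp hx with rfl | ⟨-, h⟩ | ⟨rfl, -⟩
      · exact zero_mem _
      · exact h
      · exact absurd rfl hj
    · rw [Q.part_eq_bot h0 h1]
      exact disjoint_bot_left
  · rw [eq_top_iff, ← Q.isCompl.sup_eq_top]
    exact sup_le (Q.part_zero.symm.trans_le (le_iSup _ _)) (Q.part_one.symm.trans_le (le_iSup _ _))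

theorem cochains_ext_part {F G : Cochains K 𝒜 𝒜}
    (h : ∀ (n : ℕ) (d : ℕ → ℤ) (x : ℕ → 𝒜), (∀ j, d j = 0 ∧ x j ∈ Q.A ∨ d j = 1 ∧ x j ∈ Q.A') →
      evalSeq n x F = evalSeq n x G) : F = G :=
  cochains_ext_homogeneous Q.isInternal_part.submodule_iSup_eq_top fun n d x hx =>
    h n d x fun j => (Q.mem_part_iff.mp (hx j).2).resolve_left (hx j).1

theorem bilinCochain_mem_weight_part {w : ℤ} {B : 𝒜 →ₗ[K] 𝒜 →ₗ[K] 𝒜}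
    (hAA : ∀ x y : Q.A, B x y ∈ Q.part w) (hAA' : ∀ (x : Q.A) (v : Q.A'), B x v ∈ Q.part (1 + w))
    (hA'A : ∀ (u : Q.A') (y : Q.A), B u y ∈ Q.part (1 + w))
    (hA'A' : ∀ u v : Q.A', B u v ∈ Q.part (2 + w)) : bilinCochain B ∈ weight Q.part w := by
  refine bilinCochain_mem_weight fun i j x hx y hy => ?_
  rcases Q.mem_part_iff.mp hx with rfl | hx'
  · rw [map_zero]
    exact zero_mem _
  rcases Q.mem_part_iff.mp hy with rfl | hy'
  · rw [map_zero]
    exact zero_mem _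
  rcases hx' with ⟨rfl, hxA⟩ | ⟨rfl, hxA'⟩ <;> rcases hy' with ⟨rfl, hyA⟩ | ⟨rfl, hyA'⟩
  · simpa using hAA ⟨x, hxA⟩ ⟨y, hyA⟩
  · simpa using hAA' ⟨x, hxA⟩ ⟨y, hyA'⟩
  · simpa using hA'A ⟨x, hxA'⟩ ⟨y, hyA⟩
  · simpa using hA'A' ⟨x, hxA'⟩ ⟨y, hyA'⟩

theorem liftπρμ_mem_weight : bilinCochain Q.liftπρμ ∈ weight Q.part 0 := by
  apply Q.bilinCochain_mem_weight_part <;> intro x y <;>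
  simp [liftπρμ, part_zero, part_one, pr_coe, pr_coe', pr'_coe, pr'_coe']

theorem liftξηβ_mem_weight : bilinCochain Q.liftξηβ ∈ weight Q.part (-1) := by
  apply Q.bilinCochain_mem_weight_part <;> intro x y <;>
  simp [liftξηβ, part_zero, part_one, pr_coe, pr_coe', pr'_coe, pr'_coe']

theorem lift_apply (F : Cochains K Q.A Q.A') (n : ℕ) (x : ℕ → 𝒜) :
    evalSeq n x (Q.lift F) = ((evalSeq n (fun k => Q.pr (x k)) F : Q.A') : 𝒜) := rfl

theorem proj_apply (F : Cochains K 𝒜 𝒜) (n : ℕ) (x : ℕ → Q.A) :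
    evalSeq n x (Q.proj F) = Q.pr' (evalSeq n (fun k => (x k : 𝒜)) F) := rfl

theorem lift_mem_weight (F : Cochains K Q.A Q.A') : Q.lift F ∈ weight Q.part 1 := by
  intro n d x hx
  rw [lift_apply]
  by_cases hd : ∀ j ∈ Finset.range (n + 1), d j = 0
  · rw [Finset.sum_eq_zero hd, zero_add, part_one]
    exact Submodule.coe_mem _
  · push Not at hd
    obtain ⟨j, hj, hdj⟩ := hd
    have hpr : Q.pr (x j) = 0 := by
      rcases Q.mem_part_iff.mp (hx j) with h | ⟨h, -⟩ | ⟨-, h⟩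
      · rw [h, map_zero]
      · exact absurd h hdj
      · exact Q.pr_of_mem' h
    rw [evalSeq_eq_zero F hj hpr]
    exact zero_mem _

theorem proj_lift (F : Cochains K Q.A Q.A') : Q.proj (Q.lift F) = F := by
  refine cochains_ext_seq fun n x => ?_
  rw [proj_apply, lift_apply, pr'_coe']
  simp only [pr_coe]

theorem lift_injective : Function.Injective Q.lift :=
  Function.LeftInverse.injective Q.proj_lift

theorem lift_proj {F : Cochains K 𝒜 𝒜} (hF : F ∈ weight Q.part 1) : Q.lift (Q.proj F) = F := by
  refine Q.cochains_ext_part fun n d x hx => ?_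
  have hFx := hF n d x fun j => Q.mem_part_iff.mpr (Or.inr (hx j))
  rw [lift_apply, proj_apply]
  by_cases hd : ∀ j ∈ Finset.range (n + 1), d j = 0
  · have hxA : ∀ j : Fin (n + 1), (Q.pr (x j) : 𝒜) = x j := fun j => by
      rcases hx j with ⟨-, h⟩ | ⟨h, -⟩
      · rw [Q.pr_of_mem h]
      · exact absurd (h.symm.trans (hd j (Finset.mem_range.mpr j.2))) one_ne_zero
    rw [Finset.sum_eq_zero hd, zero_add, part_one] at hFx
    have hpr : evalSeq n (fun k => (Q.pr (x k) : 𝒜)) F = evalSeq n x F :=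
      congrArg (F n) (funext hxA)
    rw [hpr, Q.pr'_of_mem' hFx]
  · push Not at hd
    obtain ⟨j, hj, hdj⟩ := hd
    obtain ⟨hdj, hxj⟩ := (hx j).resolve_left fun h => hdj h.1
    have hsum : 1 ≤ ∑ j ∈ Finset.range (n + 1), d j :=
      hdj ▸ Finset.single_le_sum (fun j _ => by rcases hx j with h | h <;> omega) hj
    rw [Q.part_eq_bot (by omega) (by omega), Submodule.mem_bot] at hFx
    rw [hFx, evalSeq_eq_zero F hj (by rw [Q.pr_of_mem' hxj, Submodule.coe_zero]), map_zero,
      Submodule.coe_zero]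

theorem eq_zero_of_mem_weight {w : ℤ} (hw : 1 < w) {F : Cochains K 𝒜 𝒜}
    (hF : F ∈ weight Q.part w) : F = 0 := by
  refine Q.cochains_ext_part fun n d x hx => ?_
  have hFx := hF n d x fun j => Q.mem_part_iff.mpr (Or.inr (hx j))
  have hsum : 0 ≤ ∑ j ∈ Finset.range (n + 1), d j :=
    Finset.sum_nonneg fun j _ => by rcases hx j with h | h <;> omega
  rw [Q.part_eq_bot (by omega) (by omega), Submodule.mem_bot] at hFx
  rw [hFx, map_zero]

theorem gerstenhaberBracket_lift_lift (F G : Cochains K Q.A Q.A') :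
    gerstenhaberBracket (Q.lift F) (Q.lift G) = 0 :=
  Q.eq_zero_of_mem_weight one_lt_two
    (gerstenhaberBracket_mem_weight (Q.lift_mem_weight F) (Q.lift_mem_weight G) one_add_one_eq_two)

theorem lift_mem_cochainDegree_iff {i : ℤ} {F : Cochains K Q.A Q.A'} :
    Q.lift F ∈ cochainDegree K 𝒜 𝒜 i ↔ F ∈ cochainDegree K Q.A Q.A' i := by
  constructor
  · intro h n hn
    rw [← Q.proj_lift F, proj, DirectSum.lmap_apply, h n hn, map_zero]
  · intro h n hn
    rw [lift, DirectSum.lmap_apply, h n hn, map_zero]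

theorem lift_l₁ (F : Cochains K Q.A Q.A') :
    Q.lift (Q.l₁ F) = gerstenhaberBracket (bilinCochain Q.liftπρμ) (Q.lift F) :=
  Q.lift_proj (gerstenhaberBracket_mem_weight Q.liftπρμ_mem_weight (Q.lift_mem_weight F)
    (zero_add 1))

theorem lift_l₂ (F G : Cochains K Q.A Q.A') :
    Q.lift (Q.l₂ F G) =
      gerstenhaberBracket (gerstenhaberBracket (bilinCochain Q.liftξηβ) (Q.lift F)) (Q.lift G) :=
  Q.lift_proj (gerstenhaberBracket_mem_weight
    (gerstenhaberBracket_mem_weight Q.liftξηβ_mem_weight (Q.lift_mem_weight F) (neg_add_cancel 1))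
    (Q.lift_mem_weight G) (zero_add 1))

theorem lift_bilinCochain (B : Q.A →ₗ[K] Q.A →ₗ[K] Q.A') :
    Q.lift (bilinCochain B) = bilinCochain ((B.compl₁₂ Q.pr Q.pr).compr₂ Q.A'.subtype) := by
  refine cochains_ext_seq fun n x => ?_
  rw [lift_apply, evalSeq_bilinCochain, evalSeq_bilinCochain]
  split_ifs <;> rfl

theorem proj_bilinCochain (B : 𝒜 →ₗ[K] 𝒜 →ₗ[K] 𝒜) :
    Q.proj (bilinCochain B) =
      bilinCochain ((B.compl₁₂ Q.A.subtype Q.A.subtype).compr₂ Q.pr') := by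
  refine cochains_ext_seq fun n x => ?_
  rw [proj_apply, evalSeq_bilinCochain, evalSeq_bilinCochain]
  split_ifs
  · rfl
  · exact map_zero _

theorem lift_linCochain (E : Q.A →ₗ[K] Q.A') :
    Q.lift (linCochain E) = linCochain (Q.A'.subtype.comp (E.comp Q.pr)) := by
  refine cochains_ext_seq fun n x => ?_
  rw [lift_apply, evalSeq_linCochain, evalSeq_linCochain]
  split_ifs <;> rfl

theorem bilinCochain_mul :
    bilinCochain (LinearMap.mul K 𝒜) =
      Q.lift Q.l₀ + bilinCochain Q.liftπρμ + bilinCochain Q.liftξηβ := by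
  rw [l₀, lift_bilinCochain, ← bilinCochain_add, ← bilinCochain_add]
  congr 1
  refine LinearMap.ext₂ fun x y => ?_
  have hβ : Q.pr (Q.pr' x * Q.pr' y : 𝒜) = 0 :=
    Q.pr_of_mem' (Q.mul_mem _ (Q.pr' x).2 _ (Q.pr' y).2)
  rw [LinearMap.mul_apply']
  conv_lhs => rw [← Q.pr_add_pr' x, ← Q.pr_add_pr' y, add_mul, mul_add, mul_add,
    ← Q.pr_add_pr' (Q.pr x * Q.pr y), ← Q.pr_add_pr' (Q.pr x * Q.pr' y),
    ← Q.pr_add_pr' (Q.pr' x * Q.pr y), ← Q.pr_add_pr' (Q.pr' x * Q.pr' y), hβ]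
  simp only [ZeroMemClass.coe_zero, zero_add, θ, liftπρμ, π, ρ, μ, liftξηβ, ξ, η, β,
    LinearMap.add_apply, LinearMap.compr₂_apply, LinearMap.compl₁₂_apply, Submodule.subtype_apply,
    LinearMap.mul_apply_apply]
  abel

theorem lift_l₀_mem_cochainDegree : Q.lift Q.l₀ ∈ cochainDegree K 𝒜 𝒜 1 :=
  Q.lift_mem_cochainDegree_iff.mpr (bilinCochain_mem_cochainDegree _)

theorem sum_gerstenhaberBracket_components_eq_zero :
    gerstenhaberBracket (bilinCochain Q.liftξηβ) (bilinCochain Q.liftξηβ) +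
      (2 : K) • gerstenhaberBracket (bilinCochain Q.liftπρμ) (bilinCochain Q.liftξηβ) +
      (gerstenhaberBracket (bilinCochain Q.liftπρμ) (bilinCochain Q.liftπρμ) +
        (2 : K) • gerstenhaberBracket (bilinCochain Q.liftξηβ) (Q.lift Q.l₀)) +
      (2 : K) • gerstenhaberBracket (bilinCochain Q.liftπρμ) (Q.lift Q.l₀) +
      gerstenhaberBracket (Q.lift Q.l₀) (Q.lift Q.l₀) = 0 := by
  have hassoc := gerstenhaberBracket_bilinCochain_self (LinearMap.mul K 𝒜) mul_assoc
  have hlie := isGradedLieBracket_gerstenhaberBracket (K := K) (V := 𝒜)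
  have hp := bilinCochain_mem_cochainDegree Q.liftπρμ
  have hq := bilinCochain_mem_cochainDegree Q.liftξηβ
  have htp := hlie.symm_of_degree_one Q.lift_l₀_mem_cochainDegree hp
  have htq := hlie.symm_of_degree_one Q.lift_l₀_mem_cochainDegree hq
  have hqp := hlie.symm_of_degree_one hq hp
  rw [bilinCochain_mul] at hassoc
  generalize bilinCochain Q.liftπρμ = p at *
  generalize bilinCochain Q.liftξηβ = q at *
  generalize Q.lift Q.l₀ = t at *
  simp only [map_add, LinearMap.add_apply, htp, htq, hqp] at hassoc
  linear_combination (norm := module) hassoc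

theorem gerstenhaberBracket_components_eq_zero :
    gerstenhaberBracket (bilinCochain Q.liftξηβ) (bilinCochain Q.liftξηβ) = 0 ∧
    (2 : K) • gerstenhaberBracket (bilinCochain Q.liftπρμ) (bilinCochain Q.liftξηβ) = 0 ∧
    gerstenhaberBracket (bilinCochain Q.liftπρμ) (bilinCochain Q.liftπρμ) +
      (2 : K) • gerstenhaberBracket (bilinCochain Q.liftξηβ) (Q.lift Q.l₀) = 0 ∧
    (2 : K) • gerstenhaberBracket (bilinCochain Q.liftπρμ) (Q.lift Q.l₀) = 0 := by
  have hsum := Q.sum_gerstenhaberBracket_components_eq_zero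
  have ht := Q.lift_mem_weight Q.l₀
  have hp := Q.liftπρμ_mem_weight
  have hq := Q.liftξηβ_mem_weight
  generalize bilinCochain Q.liftπρμ = p at *
  generalize bilinCochain Q.liftξηβ = q at *
  generalize Q.lift Q.l₀ = t at *
  let component : Fin 5 → Cochains K 𝒜 𝒜 := ![gerstenhaberBracket q q,
    (2 : K) • gerstenhaberBracket p q,
    gerstenhaberBracket p p + (2 : K) • gerstenhaberBracket q t,
    (2 : K) • gerstenhaberBracket p t, gerstenhaberBracket t t]
  have hweight : ∀ i, component i ∈ weight Q.part (![-2, -1, 0, 1, 2] i) := by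
    intro i
    fin_cases i
    · exact gerstenhaberBracket_mem_weight hq hq rfl
    · exact Submodule.smul_mem _ _ (gerstenhaberBracket_mem_weight hp hq rfl)
    · exact add_mem (gerstenhaberBracket_mem_weight hp hp rfl)
        (Submodule.smul_mem _ _ (gerstenhaberBracket_mem_weight hq ht rfl))
    · exact Submodule.smul_mem _ _ (gerstenhaberBracket_mem_weight hp ht rfl)
    · exact gerstenhaberBracket_mem_weight ht ht rfl
  have hzero := eq_zero_of_mem_weight_of_sum_eq_zero Q.isInternal_part (by decide) hweight
    ((Fin.sum_univ_five component).trans hsum)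
  exact ⟨hzero 0, hzero 1, hzero 2, hzero 3⟩

theorem isShiftedCurvedDGLie (hK : (2 : K) ≠ 0) :
    IsShiftedCurvedDGLie (cochainDegree K Q.A Q.A') Q.l₀ Q.l₁ Q.l₂ := by
  obtain ⟨hqq, hpq, hppqt, hpt⟩ := Q.gerstenhaberBracket_components_eq_zero
  exact isGradedLieBracket_gerstenhaberBracket.isShiftedCurvedDGLie
    (hK.isUnit.isSMulRegular _) Q.lift_injective Q.lift_mem_cochainDegree_iff
    Q.gerstenhaberBracket_lift_lift Q.lift_l₁ Q.lift_l₂ (bilinCochain_mem_cochainDegree _)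
    (bilinCochain_mem_cochainDegree _) (bilinCochain_mem_cochainDegree _)
    ((smul_eq_zero_iff_right hK).mp hpt) hppqt ((smul_eq_zero_iff_right hK).mp hpq) hqq

theorem l_eq_curvedOperations : Q.l = curvedOperations Q.l₀ Q.l₁ Q.l₂ := by
  funext k
  match k with
  | 0 | 1 | 2 | _ + 3 => rfl

theorem twisted_eq_curvedOperations (D : Q.A →ₗ[K] Q.A') :
    Q.twisted D = curvedOperations 0 (Q.l₁ + Q.l₂ (linCochain D)) Q.l₂ := by
  rw [twisted, l_eq_curvedOperations, twist_curvedOperations]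

theorem l₁_linCochain (E : Q.A →ₗ[K] Q.A') :
    Q.l₁ (linCochain E) = bilinCochain (Q.ρ.compl₂ E + Q.μ.comp E - Q.π.compr₂ E) := by
  rw [l₁, LinearMap.comp_apply, LinearMap.comp_apply, lift_linCochain,
    gerstenhaberBracket_bilinCochain_linCochain, proj_bilinCochain]
  congr 1
  refine LinearMap.ext₂ fun x y => ?_
  simp only [liftπρμ, LinearMap.compr₂_apply, LinearMap.compl₁₂_apply, Submodule.subtype_apply,
    LinearMap.sub_apply, LinearMap.add_apply, LinearMap.comp_apply, LinearMap.compl₂_apply, pr_coe,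
    pr_coe', pr'_coe, pr'_coe', LinearMap.zero_apply, map_zero, map_add, map_sub, add_zero,
    zero_add]
  abel

theorem l₂_linCochain (E : Q.A →ₗ[K] Q.A') :
    Q.l₂ (linCochain E) (linCochain E) =
      (2 : K) • bilinCochain (Q.β.compl₁₂ E E - (Q.ξ.compl₂ E + Q.η.comp E).compr₂ E) := by
  rw [l₂, LinearMap.compr₂_apply, LinearMap.compl₁₂_apply, LinearMap.comp_apply, lift_linCochain,
    gerstenhaberBracket_bilinCochain_linCochain, gerstenhaberBracket_bilinCochain_linCochain,
    proj_bilinCochain, ← bilinCochain_smul]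
  congr 1
  refine LinearMap.ext₂ fun x y => ?_
  simp only [liftξηβ, LinearMap.compr₂_apply, LinearMap.compl₁₂_apply, Submodule.subtype_apply,
    LinearMap.sub_apply, LinearMap.add_apply, LinearMap.smul_apply, LinearMap.comp_apply,
    LinearMap.compl₂_apply, pr_coe, pr_coe', pr'_coe, pr'_coe', LinearMap.zero_apply,
    map_zero, map_add, map_sub, add_zero, zero_add, sub_zero]
  module

theorem isRightDeformationMap_iff (hK : (2 : K) ≠ 0) (E : Q.A →ₗ[K] Q.A') :
    Q.IsRightDeformationMap E ↔
      Q.l₀ + Q.l₁ (linCochain E) + (2⁻¹ : K) • Q.l₂ (linCochain E) (linCochain E) = 0 := by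
  rw [l₀, l₁_linCochain, l₂_linCochain, inv_smul_smul₀ hK, ← bilinCochain_add, ← bilinCochain_add,
    bilinCochain_eq_zero_iff, LinearMap.ext_iff₂, IsRightDeformationMap]
  refine forall₂_congr fun x y => ?_
  simp only [LinearMap.add_apply, LinearMap.sub_apply, LinearMap.compr₂_apply,
    LinearMap.compl₂_apply, LinearMap.compl₁₂_apply, LinearMap.comp_apply, LinearMap.zero_apply,
    map_add]
  rw [eq_comm, ← sub_eq_zero]
  exact Eq.congr_left (by abel)

end QuasiTwilled

end

theorem mainTheorem7 {K 𝒜 : Type*} [Field K] (hK : (2 : K) ≠ 0)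
    [NonUnitalRing 𝒜] [Module K 𝒜] [SMulCommClass K 𝒜 𝒜] [IsScalarTower K 𝒜 𝒜]
    (Q : QuasiTwilled K 𝒜) (D : Q.A →ₗ[K] Q.A') (hD : Q.IsRightDeformationMap D) :
    -- the operations twisted by `D` form an `L_∞`-algebra, with `l₁ᴰ(f) = l₁(f) + l₂(D, f)`,
    -- `l₂ᴰ = l₂` and `l_kᴰ = 0` for `k ≥ 3`
    IsLInfinityAlgebra (cochainDegree K Q.A Q.A') (Q.twisted D) ∧
    (∀ f, Q.twisted D 1 ![f] = Q.l₁ f + Q.l₂ (linCochain D) f) ∧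
    (∀ f g, Q.twisted D 2 ![f, g] = Q.l₂ f g) ∧
    (∀ k, 3 ≤ k → Q.twisted D k = 0) ∧
    -- its Maurer–Cartan elements are the `D'` for which `D + D'` is a right deformation map
    ∀ D' : Q.A →ₗ[K] Q.A',
      Q.IsRightDeformationMap (D + D') ↔
        IsMaurerCartan (cochainDegree K Q.A Q.A') (Q.twisted D) (linCochain D') := by
  have hQ := Q.isShiftedCurvedDGLie hK
  have hMC := (Q.isRightDeformationMap_iff hK D).mp hD
  have hDdeg : linCochain D ∈ cochainDegree K Q.A Q.A' 0 := linCochain_mem_cochainDegree D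
  rw [Q.twisted_eq_curvedOperations]
  refine ⟨⟨(hQ.twist hK hDdeg hMC).isCurvedLInfinityAlgebra isInternal_cochainDegree, rfl⟩,
    fun f => rfl, fun f g => rfl, fun k hk => curvedOperations_of_three_le hk, fun D' => ?_⟩
  have hD'deg : linCochain D' ∈ cochainDegree K Q.A Q.A' 0 := linCochain_mem_cochainDegree D'
  have hsymm : Q.l₂ (linCochain D) (linCochain D') = Q.l₂ (linCochain D') (linCochain D) := by
    simpa using hQ.symm hDdeg hD'deg
  rw [Q.isRightDeformationMap_iff hK, linCochain_add, maurerCartan_add_iff hK hMC hsymm,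
    isMaurerCartan_curvedOperations_iff, and_iff_right hD'deg, zero_add]
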